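/- Let $\kappa$ be a measurable cardinal, and let $\langle \mu_i : i<\kappa\rangle$ be a sequence of pairwise distinct measurable cardinals with $\mu_i>\kappa$ for all $i<\kappa$. Then there are a normal measure $\mathcal U$ on $\kappa$ and a sequence $\vec{\mathcal V}=\langle \mathcal V_i : i<\kappa\rangle$, where each $\mathcal V_i$ is a normal measure on $\mu_i$ of Mitchell order zero (i.e. $\mathrm{Ult}(V,\mathcal V_i)$ contains no normal measure on $\mu_i$), such that for every infinite cardinal $\nu$ there is a collection $\mathcal M$ of exactly $\nu$ many distinct classes with the following properties. 1. Every $M\in\mathcal M$ is a transitive class containing all ordinals, and $(M,\in)$ has the same first-order theory as $(V,\in)$. 2. Any two members of $\mathcal M$ are mutually embeddable: for all $M,N\in\mathcal M$ there is an elementary embedding $(M,\in)\to(N,\in)$. 3. Every $M\in\mathcal M$ is an iterated ultrapower of $V$ of the following form: there are an ordinal $\theta$ and a binary sequence $f$ of length $\theta$ such that $M=M_\theta$, where $\langle M_\alpha, j_{\alpha,\beta} : \alpha\le\beta\le\theta\rangle$ is the commuting system of transitive classes and elementary embeddings $j_{\alpha,\beta}:M_\alpha\to M_\beta$ with $M_0=V$,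 direct limits at limit stages, and the following successor steps. Let $i:M_\alpha\to M^*=\mathrm{Ult}(M_\alpha,j_{0,\alpha}(\mathcal U))$ be the ultrapower map. If $f(\alpha)=0$, then $M_{\alpha+1}=M^*$ and $j_{\alpha,\alpha+1}=i$. If $f(\alpha)=1$, then $M_{\alpha+1}=\mathrm{Ult}(M^*,W)$, where $W$ is the entry with index $j_{0,\alpha}(\kappa)$ of the sequence $i(j_{0,\alpha}(\vec{\mathcal V}))$, and $j_{\alpha,\alpha+1}$ is $i$ followed by the ultrapower map of $M^*$ by $W$. (Ultrapowers and direct limits are identified with their transitive collapses.) -/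

import Mathlib

open FirstOrder Cardinal

universe u

namespace MutualEmbed

/-! The universe `V` is `ZFSet.{u}`; classes are subsets of `ZFSet.{u}`, with `V` itself being
`Set.univ`. A transitive class is regarded as a structure for the language of set theory, with the
true membership relation. -/

/-- The relation symbols of the language of set theory: one binary symbol. -/
inductive SetRel : ℕ → Type
  | mem : SetRel 2

/-- The first-order language of set theory. -/
def setLang : FirstOrder.Language.{0, 0} := ⟨fun _ => Empty, SetRel⟩

/-- A class as a structure under the membership relation. -/
instance classStructure (M : Set ZFSet.{u}) : setLang.Structure M where
  funMap := fun f => Empty.elim f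
  RelMap := fun r =>
    match r with
    | SetRel.mem => fun x => ((x 0 : M) : ZFSet.{u}) ∈ ((x 1 : M) : ZFSet.{u})

/-- Transitive classes. -/
def IsTransClass (M : Set ZFSet.{u}) : Prop := ∀ x ∈ M, ∀ y ∈ x, y ∈ M

/-- `U` is a `κ`-complete nonprincipal ultrafilter on (the von Neumann ordinal) `κ`, where `κ` is
an uncountable cardinal. -/
structure IsMeasure (κ : Cardinal.{u}) (U : ZFSet.{u}) : Prop where
  uncountable : ℵ₀ < κ
  subset : ∀ X ∈ U, X ⊆ κ.ord.toZFSet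
  mono : ∀ X ∈ U, ∀ Y, X ⊆ Y → Y ⊆ κ.ord.toZFSet → Y ∈ U
  ultra : ∀ X, X ⊆ κ.ord.toZFSet → (X ∈ U ↔ κ.ord.toZFSet \ X ∉ U)
  nonprincipal : ∀ x : ZFSet.{u}, ({x} : ZFSet.{u}) ∉ U
  complete : ∀ S : ZFSet.{u}, S ⊆ U → S.Nonempty → S.card < κ → S.sInter ∈ U

/-- A measure is normal if every function that is regressive on a set of measure one is constant
on a set of measure one. -/
structure IsNormalMeasure (κ : Cardinal.{u}) (U : ZFSet.{u}) : Prop extends IsMeasure κ U where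
  normal : ∀ X ∈ U, ∀ f : ZFSet.{u} → ZFSet.{u}, (∀ ξ ∈ X, f ξ ∈ ξ) →
    ∃ γ, X.sep (fun ξ => f ξ = γ) ∈ U

/-- Measurable cardinals. -/
def IsMeasurable (κ : Cardinal.{u}) : Prop := ∃ U, IsMeasure κ U

/-- The functions with domain the set `I` that are elements of `M`. -/
def funcsOn (M : Set ZFSet.{u}) (I : ZFSet.{u}) : Set ZFSet.{u} :=
  {f | f ∈ M ∧ ∃ y, ZFSet.IsFunc I y f}

/-- The set of all `ξ ∈ I` for which `R (f ξ) (g ξ)` holds. -/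
def valSet (R : ZFSet.{u} → ZFSet.{u} → Prop) (I f g : ZFSet.{u}) : ZFSet.{u} :=
  I.sep (fun ξ => ∃ a b, ZFSet.pair ξ a ∈ f ∧ ZFSet.pair ξ b ∈ g ∧ R a b)

/-- `N` is the transitive collapse of the ultrapower of `M` by `W`, formed with the functions that
belong to `M`, and `i` is the ultrapower map. Here `W ∈ M` is an ultrafilter on the set `⋃₀ W`, and
`rep f` is the element of `N` represented by the function `f`. -/
def IsUltrapower (M : Set ZFSet.{u}) (W : ZFSet.{u}) (N : Set ZFSet.{u}) (i : M → N) : Prop :=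
  W ∈ M ∧ IsTransClass N ∧
  ∃ rep : funcsOn M W.sUnion → N, Function.Surjective rep ∧
    (∀ f g, rep f = rep g ↔ valSet (· = ·) W.sUnion f g ∈ W) ∧
    (∀ f g, (rep f : ZFSet.{u}) ∈ (rep g : ZFSet.{u}) ↔ valSet (· ∈ ·) W.sUnion f g ∈ W) ∧
    ∀ x : M, ∃ c : funcsOn M W.sUnion,
      (c : ZFSet.{u}) = W.sUnion.prod {(x : ZFSet.{u})} ∧ i x = rep c

/-- The normal measure `W` on `μ` has Mitchell order zero: no normal measure on `μ` belongs to the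
ultrapower of `V` by `W`. -/
def MitchellOrderZero (μ : Cardinal.{u}) (W : ZFSet.{u}) : Prop :=
  ∃ (N : Set ZFSet.{u}) (i : ↥(Set.univ : Set ZFSet.{u}) → N),
    IsUltrapower Set.univ W N i ∧ ∀ W' ∈ N, ¬ IsNormalMeasure μ W'

/-- The sequence `⟨v i : i < κ⟩` as a set, i.e. as a function with domain `κ`. -/
noncomputable def seqSet (κ : Cardinal.{u}) (v : Set.Iio κ.ord → ZFSet.{u}) : ZFSet.{u} :=
  ZFSet.range (fun i : Set.Iio κ.ord => ZFSet.pair (i : Ordinal.{u}).toZFSet (v i))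

/-- The iteration of `V` of length `θ` along the binary sequence `f`, by the measure `U` on `κ` and
the sequence `𝒱` of measures of length `κ` (and their images): transitive classes `M_α` and
commuting elementary embeddings `j_{α,β} : M_α → M_β` for `α ≤ β ≤ θ`, with `M_0 = V`.

If `f α = 0`, then `M_{α+1}` is the ultrapower of `M_α` by `j_{0,α}(U)`. If `f α = 1`, one first
takes this ultrapower `i : M_α → N` and then the ultrapower of `N` by the entry of the sequence
`i (j_{0,α}(𝒱))` with index `j_{0,α}(κ)`. Direct limits are taken at limit stages. -/
structure Iteration (κ : Cardinal.{u}) (U 𝒱 : ZFSet.{u}) (θ : Ordinal.{u})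
    (f : Ordinal.{u} → Bool) where
  model : Ordinal.{u} → Set ZFSet.{u}
  map : ∀ α β : Ordinal.{u}, α ≤ β → β ≤ θ → (model α ↪ₑ[setLang] model β)
  transitive : ∀ α ≤ θ, IsTransClass (model α)
  zero : model 0 = Set.univ
  map_refl : ∀ (α : Ordinal.{u}) (h : α ≤ θ) (x : model α), map α α le_rfl h x = x
  map_comp : ∀ (α β γ : Ordinal.{u}) (h : α ≤ β) (h' : β ≤ γ) (hγ : γ ≤ θ) (x : model α),
    map β γ h' hγ (map α β h (h'.trans hγ) x) = map α γ (h.trans h') hγ x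
  succ_false : ∀ (α : Ordinal.{u}) (h : α ≤ α + 1) (hα : α + 1 ≤ θ), f α = false →
    IsUltrapower (model α)
      (map 0 α (bot_le) (h.trans hα) ⟨U, zero ▸ Set.mem_univ U⟩ : model α)
      (model (α + 1)) (map α (α + 1) h hα)
  succ_true : ∀ (α : Ordinal.{u}) (h : α ≤ α + 1) (hα : α + 1 ≤ θ), f α = true →
    ∃ (N : Set ZFSet.{u}) (i : model α → N) (W : ZFSet.{u}) (k : N → model (α + 1)),
      IsUltrapower (model α)
        (map 0 α (bot_le) (h.trans hα) ⟨U, zero ▸ Set.mem_univ U⟩ : model α) N i ∧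
      ZFSet.pair
          (map 0 α (bot_le) (h.trans hα)
            ⟨κ.ord.toZFSet, zero ▸ Set.mem_univ κ.ord.toZFSet⟩ : model α) W ∈
        (i (map 0 α (bot_le) (h.trans hα) ⟨𝒱, zero ▸ Set.mem_univ 𝒱⟩) : ZFSet.{u}) ∧
      IsUltrapower N W (model (α + 1)) k ∧
      ∀ x : model α, map α (α + 1) h hα x = k (i x)
  limit : ∀ (α : Ordinal.{u}) (hα : α ≤ θ), Order.IsSuccLimit α → ∀ y : model α,
    ∃ (β : Ordinal.{u}) (hβ : β < α) (x : model β), map β α hβ.le hα x = y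

end MutualEmbed

/-! All the models come from one filter. Attach two coordinates to every stage α: the first carries
`U` on κ, the second carries `v i`, where i < κ is the value of the first. Iterating "for almost
all" along the well-ordered coordinates gives a filter on assignments `x` that decides every
property of finitely many coordinates (`em_of_supp`). For a small set T of coordinates, `model T` is
the collapse of the functions with finite support in T. Łoś's theorem holds (`realize_iff`), and T =
∅ gives V.

Adding a coordinate c to T amounts to an ultrapower by its measure (`isUltrapower_insert`), provided
that redrawing `x c` does not change which sets supported in `insert c T` are large (`Resamp`). If c
is above all of T this is Fubini. A second coordinate may be redrawn even under later ones, because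
its measure commutes with theirs: they live on different cardinals (`resamp_snd`). Finite supports
turn limit stages into direct limits. Hence the α-th model along f is `model` of the coordinates
that f switches on below α.

Given ν, take length `ν.ord` and, for each ξ < `ν.ord`, the sequence that is 0 only at ξ. Two such
models, for ξ and η, are ultrapowers of one common model: the first by the second measure of stage
η, the other by that of stage ξ. Suppose the measure at ξ lives on the smaller cardinal. Then the
ultrapower at η does not move it (`val_eq_of_rigid`), while its own ultrapower omits it, because it
has order zero (`val_W_notMem_model`). So the models differ. Shifting all stages by η + 1 preserves
the filter and jumps over the omitted stage η, so it embeds the model for any ξ into the model for η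
(`nonempty_embedding_omitAt`).

Order-zero measures exist by ∈-induction (`IsNormalUF.exists_orderZero`). -/

namespace MutualEmbed

open Filter

universe w

/-! ### Measures as ultrafilters on the universe -/

/-- The ultrafilter `l` is closed under intersections of fewer than `κ` sets. -/
def CompleteBelow (l : Filter ZFSet.{u}) (κ : Cardinal.{u}) : Prop :=
  ∀ S : ZFSet.{u}, S.card < κ → ∀ P : ZFSet.{u} → ZFSet.{u} → Prop,
    (∀ b ∈ S, ∀ᶠ z in l, P b z) → ∀ᶠ z in l, ∀ b ∈ S, P b z

namespace IsMeasure

variable {κ : Cardinal.{u}} {W : ZFSet.{u}}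

theorem ord_pos (h : IsMeasure κ W) : 0 < κ.ord := by
  rw [Cardinal.ord_pos]
  exact Cardinal.aleph0_pos.trans h.uncountable

/-- If ∅ were large, upward closure would make the singleton `{∅}` large. -/
theorem empty_notMem (h : IsMeasure κ W) : (∅ : ZFSet.{u}) ∉ W := fun he =>
  h.nonprincipal ∅ <| h.mono _ he _ (ZFSet.empty_subset _) fun x hx => by
    rw [ZFSet.mem_singleton.1 hx, Ordinal.mem_toZFSet_iff]
    exact ⟨0, h.ord_pos, by simp⟩

theorem ord_mem (h : IsMeasure κ W) : κ.ord.toZFSet ∈ W := by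
  rw [h.ultra _ (fun _ hx => hx)]
  convert! h.empty_notMem
  ext; simp

theorem sUnion_eq (h : IsMeasure κ W) : (ZFSet.sUnion W) = κ.ord.toZFSet := by
  ext x
  rw [ZFSet.mem_sUnion]
  exact ⟨fun ⟨z, hz, hx⟩ => h.subset z hz hx, fun hx => ⟨_, h.ord_mem, hx⟩⟩

theorem sep_forall_mem (h : IsMeasure κ W) {S : ZFSet.{u}} (hS : S.card < κ)
    {P : ZFSet.{u} → ZFSet.{u} → Prop} (hP : ∀ b ∈ S, κ.ord.toZFSet.sep (P b) ∈ W) :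
    κ.ord.toZFSet.sep (fun z => ∀ b ∈ S, P b z) ∈ W := by
  -- `complete` speaks of nonempty families only.
  rcases ZFSet.eq_empty_or_nonempty S with rfl | ⟨b₀, hb₀⟩
  · convert! h.ord_mem
    ext; simp
  let T : ZFSet.{u} := ZFSet.range (fun b : S => κ.ord.toZFSet.sep (P b))
  have hT : ∀ z, z ∈ T ↔ ∃ b ∈ S, κ.ord.toZFSet.sep (P b) = z := by
    intro z
    simp [T, ZFSet.mem_range]
  have hc : T.card < κ := by
    refine lt_of_le_of_lt ?_ hS
    have := ZFSet.lift_card_range_le (f := fun b : S => κ.ord.toZFSet.sep (P b))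
    rw [ZFSet.cardinalMk_coe_sort, Cardinal.lift_lift] at this
    exact Cardinal.lift_le.1 this
  have hTne : T.Nonempty := ⟨κ.ord.toZFSet.sep (P b₀), (hT _).2 ⟨b₀, hb₀, rfl⟩⟩
  have := h.complete T (fun z hz => by obtain ⟨b, hb, rfl⟩ := (hT z).1 hz; exact hP b hb) hTne hc
  have e : κ.ord.toZFSet.sep (fun z => ∀ b ∈ S, P b z) = ZFSet.sInter T := ?_
  · rwa [e]
  ext z
  rw [ZFSet.mem_sInter hTne]
  constructor
  · intro hz y hy
    obtain ⟨b, hb, rfl⟩ := (hT y).1 hy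
    rw [ZFSet.mem_sep] at hz ⊢
    exact ⟨hz.1, hz.2 b hb⟩
  · intro hz
    rw [ZFSet.mem_sep]
    have : ∀ b ∈ S, z ∈ κ.ord.toZFSet.sep (P b) := fun b hb => hz _ ((hT _).2 ⟨b, hb, rfl⟩)
    exact ⟨(ZFSet.mem_sep.1 (this b₀ hb₀)).1, fun b hb => (ZFSet.mem_sep.1 (this b hb)).2⟩

theorem inter_mem (h : IsMeasure κ W) {A B : ZFSet.{u}} (hA : A ∈ W) (hB : B ∈ W) :
    A ∩ B ∈ W := by
  have hc : ({A, B} : ZFSet.{u}).card < κ := by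
    refine lt_of_le_of_lt ?_ h.uncountable
    refine (ZFSet.card_insert_le).trans ?_
    rw [ZFSet.card_singleton]
    exact (Cardinal.natCast_lt_aleph0 (n := 2)).le.trans' (by norm_num)
  have := h.complete {A, B} (fun z hz => by
    rcases ZFSet.mem_pair.1 hz with rfl | rfl <;> assumption) ⟨A, by simp⟩ hc
  refine (?_ : A ∩ B = ZFSet.sInter {A, B}) ▸ this
  ext z
  rw [ZFSet.mem_sInter ⟨A, by simp⟩]
  simp

/-- The ultrafilter on the universe given by a measure. -/
def uf (h : IsMeasure κ W) : Ultrafilter ZFSet.{u} :=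
  Ultrafilter.ofComplNotMemIff
    { sets := {A | κ.ord.toZFSet.sep (· ∈ A) ∈ W}
      univ_sets := by
        have e : κ.ord.toZFSet.sep (· ∈ Set.univ) = κ.ord.toZFSet := by ext; simp
        rw [Set.mem_ofPred_eq, e]
        exact h.ord_mem
      sets_of_superset := fun {A B} hA hAB => h.mono _ hA _
        (fun z hz => by rw [ZFSet.mem_sep] at hz ⊢; exact ⟨hz.1, hAB hz.2⟩) ZFSet.sep_subset
      inter_sets := fun {A B} hA hB => by
        have e : κ.ord.toZFSet.sep (· ∈ A ∩ B) =
            κ.ord.toZFSet.sep (· ∈ A) ∩ κ.ord.toZFSet.sep (· ∈ B) := by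
          ext; simp; tauto
        rw [Set.mem_ofPred_eq, e]
        exact h.inter_mem hA hB }
    (fun A => by
      change κ.ord.toZFSet.sep (· ∈ Aᶜ) ∉ W ↔ κ.ord.toZFSet.sep (· ∈ A) ∈ W
      rw [h.ultra _ (ZFSet.sep_subset (x := κ.ord.toZFSet) (p := (· ∈ A)))]
      convert! Iff.rfl using 3
      ext; simp; tauto)

theorem eventually_iff (h : IsMeasure κ W) {P : ZFSet.{u} → Prop} :
    (∀ᶠ z in h.uf, P z) ↔ κ.ord.toZFSet.sep P ∈ W := Iff.rfl

theorem mem_iff (h : IsMeasure κ W) {A : ZFSet.{u}} (hA : A ⊆ κ.ord.toZFSet) :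
    A ∈ W ↔ ∀ᶠ z in h.uf, z ∈ A := by
  rw [h.eventually_iff]
  convert! Iff.rfl using 2
  simp [hA]

theorem eventually_mem (h : IsMeasure κ W) : ∀ᶠ z in h.uf, z ∈ κ.ord.toZFSet :=
  (h.mem_iff (fun _ hx => hx)).1 h.ord_mem

theorem completeBelow (h : IsMeasure κ W) : CompleteBelow h.uf κ :=
  fun _ hS _ hP => h.sep_forall_mem hS hP

theorem eventually_ne (h : IsMeasure κ W) (x : ZFSet.{u}) : ∀ᶠ z in h.uf, z ≠ x := by
  rw [← not_not (a := ∀ᶠ z in h.uf, z ≠ x), ← Ultrafilter.eventually_not]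
  intro hx
  have hx' : ∀ᶠ z in h.uf, z ∈ ({x} : ZFSet.{u}) := hx.mono fun z hz => by simpa using hz
  obtain ⟨z, hz, hzκ⟩ := (hx.and h.eventually_mem).exists
  refine h.nonprincipal x ((h.mem_iff ?_).2 hx')
  intro y hy
  rw [ZFSet.mem_singleton.1 hy, ← not_not.1 hz]
  exact hzκ

end IsMeasure

theorem isOrdinal_of_mem_toZFSet {o : Ordinal.{u}} {x : ZFSet.{u}} (hx : x ∈ o.toZFSet) :
    x.IsOrdinal :=
  (ZFSet.isOrdinal_toZFSet o).mem hx

theorem mem_trans_toZFSet {o : Ordinal.{u}} {x y : ZFSet.{u}} (hx : x ∈ y) (hy : y ∈ o.toZFSet) :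
    x ∈ o.toZFSet :=
  (ZFSet.isOrdinal_toZFSet o).mem_trans hx hy

theorem card_lt_of_mem_ord {κ : Cardinal.{u}} {x : ZFSet.{u}} (hx : x ∈ κ.ord.toZFSet) :
    x.card < κ := by
  obtain ⟨a, ha, rfl⟩ := Ordinal.mem_toZFSet_iff.1 hx
  rw [Ordinal.card_toZFSet]
  exact Cardinal.lt_ord.1 ha

theorem succ_mem_ord {κ : Cardinal.{u}} (hκ : ℵ₀ ≤ κ) {x : ZFSet.{u}}
    (hx : x ∈ κ.ord.toZFSet) : insert x x ∈ κ.ord.toZFSet := by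
  obtain ⟨a, ha, rfl⟩ := Ordinal.mem_toZFSet_iff.1 hx
  rw [← Ordinal.toZFSet_add_one, Ordinal.toZFSet_mem_toZFSet_iff]
  exact (Cardinal.isSuccLimit_ord hκ).add_one_lt ha

theorem CompleteBelow.exists_eq {l : Ultrafilter ZFSet.{u}} {κ : Cardinal.{u}}
    (h : CompleteBelow l κ) {B : ZFSet.{u}} (hB : B.card < κ) {f : ZFSet.{u} → ZFSet.{u}}
    (hf : ∀ᶠ z in l, f z ∈ B) : ∃ b ∈ B, ∀ᶠ z in l, f z = b := by
  by_contra! hne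
  have := h B hB (fun b z => f z ≠ b) fun b hb => by
    exact hne b hb
  obtain ⟨z, hz, hz'⟩ := (hf.and this).exists
  exact hz' _ hz rfl

/-- A normal ultrafilter on the ordinal `δ`. -/
structure IsNormalUF (δ : ZFSet.{u}) (l : Ultrafilter ZFSet.{u}) : Prop where
  mem : ∀ᶠ ζ in l, ζ ∈ δ
  tail : ∀ γ ∈ δ, ∀ᶠ ζ : ZFSet.{u} in l, γ ∈ ζ
  normal : ∀ f : ZFSet.{u} → ZFSet.{u}, (∀ᶠ ζ in l, f ζ ∈ ζ) → ∃ γ, ∀ᶠ ζ in l, f ζ = γ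

/-- Fewer than κ points lie at or below γ, and almost every ζ avoids each of them, hence all of
them. -/
theorem IsMeasure.eventually_tail {κ : Cardinal.{u}} {W : ZFSet.{u}} (h : IsMeasure κ W)
    {γ : ZFSet.{u}} (hγ : γ ∈ κ.ord.toZFSet) : ∀ᶠ ζ : ZFSet.{u} in h.uf, γ ∈ ζ := by
  have hs := succ_mem_ord h.uncountable.le hγ
  have := h.completeBelow _ (card_lt_of_mem_ord hs) (fun b ζ => ζ ≠ b)
    fun b _ => h.eventually_ne b
  filter_upwards [this, h.eventually_mem] with ζ h1 h2
  rcases (isOrdinal_of_mem_toZFSet hγ).mem_trichotomous (isOrdinal_of_mem_toZFSet h2) with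
    h3 | h3 | h3
  · exact h3
  · exact absurd h3.symm (h1 _ (ZFSet.mem_insert _ _))
  · exact absurd rfl (h1 _ (ZFSet.mem_insert_of_mem _ h3))

theorem IsNormalMeasure.isNormalUF {κ : Cardinal.{u}} {W : ZFSet.{u}} (h : IsNormalMeasure κ W) :
    IsNormalUF κ.ord.toZFSet h.toIsMeasure.uf where
  mem := h.toIsMeasure.eventually_mem
  tail := fun _ hγ => h.toIsMeasure.eventually_tail hγ
  normal := fun f hf => by
    obtain ⟨γ, hγ⟩ := h.normal _ (h.toIsMeasure.eventually_iff.1 hf) f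
      (fun ξ hξ => (ZFSet.mem_sep.1 hξ).2)
    refine ⟨γ, h.toIsMeasure.eventually_iff.2 (h.mono _ hγ _ ?_ ZFSet.sep_subset)⟩
    intro z hz
    simp only [ZFSet.mem_sep] at hz ⊢
    exact ⟨hz.1.1, hz.2⟩

/-! ### Consequences of normality -/

namespace IsNormalUF

variable {δ : ZFSet.{u}} {l : Ultrafilter ZFSet.{u}}

/-- A choice of counterexamples γ ∈ ζ would be regressive, hence constant, against `hP` at that
constant. -/
theorem diagonal (h : IsNormalUF δ l) (hδ : δ.IsOrdinal) {P : ZFSet.{u} → ZFSet.{u} → Prop}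
    (hP : ∀ γ ∈ δ, ∀ᶠ ζ in l, P γ ζ) : ∀ᶠ ζ in l, ∀ γ ∈ ζ, P γ ζ := by
  by_contra hne
  rw [← Ultrafilter.eventually_not] at hne
  have : ∀ᶠ ζ in l, ∃ γ, γ ∈ ζ ∧ ¬ P γ ζ := hne.mono fun ζ hζ => by
    push Not at hζ
    exact hζ
  obtain ⟨f, hf⟩ := this.choice
  obtain ⟨γ, hγ⟩ := h.normal f (hf.mono fun ζ hζ => hζ.1)
  have hγδ : γ ∈ δ := by
    obtain ⟨ζ, h1, h2, h3⟩ := (h.mem.and (hf.and hγ)).exists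
    exact hδ.mem_trans (h3 ▸ h2.1) h1
  obtain ⟨ζ, h1, h2, h3⟩ := ((hP γ hγδ).and (hf.and hγ)).exists
  exact h2.2 (h3 ▸ h1)

/-- Code S injectively into the ordinal of its cardinality, which lies below almost every ζ by
`tail`. A choice of failing b ∈ S then becomes a regressive function. -/
theorem completeBelow {κ : Cardinal.{u}} (h : IsNormalUF κ.ord.toZFSet l) : CompleteBelow l κ := by
  intro S hS P hP
  by_contra hne
  rw [← Ultrafilter.eventually_not] at hne
  have : ∀ᶠ ζ in l, ∃ b, b ∈ S ∧ ¬ P b ζ := hne.mono fun ζ hζ => by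
    push Not at hζ
    exact hζ
  obtain ⟨f, hf⟩ := this.choice
  have hle : Cardinal.lift.{u + 1} S.card ≤ #S.card.ord.toZFSet := by
    rw [ZFSet.cardinalMk_coe_sort, Ordinal.card_toZFSet, Cardinal.card_ord]
  rw [← ZFSet.cardinalMk_coe_sort] at hle
  obtain ⟨e⟩ := hle
  have hSκ : S.card.ord.toZFSet ∈ κ.ord.toZFSet := by
    rw [Ordinal.toZFSet_mem_toZFSet_iff]
    exact Cardinal.ord_lt_ord.2 hS
  classical
  let g : ZFSet.{u} → ZFSet.{u} := fun ζ => if hz : f ζ ∈ S then e ⟨f ζ, hz⟩ else ∅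
  have hg : ∀ᶠ ζ in l, g ζ ∈ ζ := by
    filter_upwards [hf, h.tail _ hSκ, h.mem] with ζ h1 h2 h3
    simp only [g, dif_pos h1.1]
    exact (isOrdinal_of_mem_toZFSet h3).mem_trans (e ⟨f ζ, h1.1⟩).2 h2
  obtain ⟨γ, hγ⟩ := h.normal g hg
  obtain ⟨ζ₀, h0, h0'⟩ := (hf.and hγ).exists
  have : ∀ᶠ ζ in l, f ζ = f ζ₀ := by
    filter_upwards [hf, hγ] with ζ h1 h2
    simp only [g, dif_pos h1.1, dif_pos h0.1] at h2 h0'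
    have := e.injective (Subtype.ext (h2.trans h0'.symm))
    exact congrArg Subtype.val this
  obtain ⟨ζ, h1, h2, h3⟩ := ((hP _ h0.1).and (hf.and this)).exists
  exact h2.2 (h3 ▸ h1)

/-- The set of subsets of `δ` in the ultrafilter `l`. -/
def _root_.MutualEmbed.measureSet (δ : ZFSet.{u}) (l : Ultrafilter ZFSet.{u}) : ZFSet.{u} :=
  (ZFSet.powerset δ).sep fun A => ∀ᶠ z in l, z ∈ A

theorem _root_.MutualEmbed.mem_measureSet {A : ZFSet.{u}} :
    A ∈ measureSet δ l ↔ A ⊆ δ ∧ ∀ᶠ z in l, z ∈ A := by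
  simp [measureSet]

theorem isNormalMeasure {κ : Cardinal.{u}} (hκ : ℵ₀ < κ) (h : IsNormalUF κ.ord.toZFSet l) :
    IsNormalMeasure κ (measureSet κ.ord.toZFSet l) where
  uncountable := hκ
  subset := fun X hX => (mem_measureSet.1 hX).1
  mono := fun X hX Y hXY hY => mem_measureSet.2
    ⟨hY, (mem_measureSet.1 hX).2.mono fun z hz => hXY hz⟩
  ultra := fun X hX => by
    rw [mem_measureSet, mem_measureSet, not_and, ← Ultrafilter.eventually_not]
    refine ⟨fun h' _ => h'.2.mono fun z hz => by simp [hz], fun h' => ⟨hX, ?_⟩⟩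
    filter_upwards [h' (fun z hz => by simp at hz; exact hz.1), h.mem] with z h1 h2
    simpa [h2] using h1
  nonprincipal := fun x hx => by
    obtain ⟨hx1, hx2⟩ := mem_measureSet.1 hx
    obtain ⟨z, h1, h2⟩ := (hx2.and (h.tail x (hx1 (by simp)))).exists
    rw [ZFSet.mem_singleton.1 h1] at h2
    exact ZFSet.mem_irrefl _ h2
  complete := fun S hS hne hc => by
    obtain ⟨X, hX⟩ := id hne
    refine mem_measureSet.2 ⟨fun z hz => (mem_measureSet.1 (hS hX)).1
      (ZFSet.mem_of_mem_sInter hz hX), ?_⟩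
    refine (h.completeBelow S hc (fun b z => z ∈ b)
      fun b hb => (mem_measureSet.1 (hS hb)).2).mono fun z hz => ?_
    exact (ZFSet.mem_sInter hne).2 hz
  normal := fun X hX f hf => by
    obtain ⟨γ, hγ⟩ := h.normal f ((mem_measureSet.1 hX).2.mono fun z hz => hf z hz)
    refine ⟨γ, mem_measureSet.2 ⟨fun z hz => (mem_measureSet.1 hX).1 (ZFSet.mem_sep.1 hz).1, ?_⟩⟩
    filter_upwards [hγ, (mem_measureSet.1 hX).2] with z h1 h2
    exact ZFSet.mem_sep.2 ⟨h2, h1⟩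

end IsNormalUF

/-! ### Existence of normal ultrafilters and of order-zero ones -/

/-- Membership of functions modulo a countably complete filter is well founded. -/
theorem wellFounded_eventually_mem {α : Type*} (l : Filter α) [l.NeBot]
    [CountableInterFilter l] :
    WellFounded fun F H : α → ZFSet.{u} => ∀ᶠ x in l, F x ∈ H x := by
  rw [wellFounded_iff_isEmpty_descending_chain]
  refine ⟨fun ⟨F, hF⟩ => ?_⟩
  obtain ⟨x, hx⟩ := (eventually_countable_forall.2 hF).exists
  exact (wellFounded_iff_isEmpty_descending_chain.1 ZFSet.mem_wf).false
    ⟨fun n => F n x, hx⟩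

theorem CompleteBelow.countableInterFilter {l : Filter ZFSet.{u}} {κ : Cardinal.{u}}
    (hκ : ℵ₀ < κ) (h : CompleteBelow l κ) : CountableInterFilter l := by
  refine ⟨fun S hS hl => ?_⟩
  rcases S.eq_empty_or_nonempty with rfl | hne
  · simp
  obtain ⟨f, rfl⟩ := hS.exists_eq_range hne
  let e : ℕ → ZFSet.{u} := fun n => (n : Ordinal.{u}).toZFSet
  have he : Function.Injective e := fun m n hmn => by
    exact_mod_cast Ordinal.toZFSet_injective hmn
  let B : ZFSet.{u} := Ordinal.toZFSet Ordinal.omega0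
  have hB : ∀ b, b ∈ B ↔ ∃ n, e n = b := fun b => by
    rw [Ordinal.mem_toZFSet_iff]
    constructor
    · rintro ⟨a, ha, rfl⟩
      obtain ⟨n, rfl⟩ := Ordinal.lt_omega0.1 ha
      exact ⟨n, rfl⟩
    · rintro ⟨n, rfl⟩
      exact ⟨n, Ordinal.natCast_lt_omega0 n, rfl⟩
  have := h B (by rw [Ordinal.card_toZFSet, Ordinal.card_omega0]; exact hκ)
    (fun b z => ∀ n, e n = b → z ∈ f n) (fun b hb => by
      obtain ⟨n, rfl⟩ := (hB b).1 hb
      filter_upwards [hl _ (Set.mem_range_self n)] with z hz m hm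
      rwa [he hm])
  filter_upwards [this] with z hz
  rw [Set.sInter_range, Set.mem_iInter]
  exact fun n => hz _ ((hB _).2 ⟨n, rfl⟩) n rfl

/-- Every measurable cardinal carries a normal ultrafilter. -/
theorem IsMeasurable.exists_isNormalUF {κ : Cardinal.{u}} (h : IsMeasurable κ) :
    ∃ l, IsNormalUF κ.ord.toZFSet l := by
  obtain ⟨W, hW⟩ := h
  have := hW.completeBelow.countableInterFilter hW.uncountable
  have hwf := wellFounded_eventually_mem (hW.uf : Filter ZFSet.{u})
  -- The functions into κ that exceed every constant below κ. A minimal one pushes the measure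
  -- forward to a normal ultrafilter: a function below it fails to exceed some constant, so it takes
  -- fewer than κ values and is constant by completeness.
  let S : Set (ZFSet.{u} → ZFSet.{u}) := {g | (∀ᶠ z in hW.uf, g z ∈ κ.ord.toZFSet) ∧
    ∀ γ ∈ κ.ord.toZFSet, ∀ᶠ z in hW.uf, γ ∈ g z}
  have hS : S.Nonempty := ⟨id, hW.eventually_mem, fun γ hγ => hW.eventually_tail hγ⟩
  obtain ⟨g, ⟨hg1, hg2⟩, hmin⟩ := hwf.has_min S hS
  refine ⟨hW.uf.map g, hg1, hg2, fun f hf => ?_⟩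
  have hf' : ∀ᶠ z in hW.uf, f (g z) ∈ g z := hf
  have hns : (fun z => f (g z)) ∉ S := fun hs => hmin _ hs hf'
  have hfκ : ∀ᶠ z in hW.uf, f (g z) ∈ κ.ord.toZFSet := by
    filter_upwards [hf', hg1] with z h1 h2 using mem_trans_toZFSet h1 h2
  have : ∃ γ ∈ κ.ord.toZFSet, ¬ ∀ᶠ z in hW.uf, γ ∈ f (g z) := by
    by_contra! hcon
    exact hns ⟨hfκ, hcon⟩
  obtain ⟨γ, hγ, hγ'⟩ := this
  rw [← Ultrafilter.eventually_not] at hγ'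
  have hs := succ_mem_ord hW.uncountable.le hγ
  obtain ⟨b, -, hb⟩ := hW.completeBelow.exists_eq (card_lt_of_mem_ord hs) (f := fun z => f (g z)) (by
    filter_upwards [hγ', hfκ] with z h1 h2
    rcases (isOrdinal_of_mem_toZFSet hγ).mem_trichotomous (isOrdinal_of_mem_toZFSet h2) with
      h3 | h3 | h3
    · exact absurd h3 h1
    · exact h3 ▸ ZFSet.mem_insert _ _
    · exact ZFSet.mem_insert_of_mem _ h3)
  exact ⟨b, hb⟩

/-- If an ordinal carries a normal ultrafilter, it carries one that concentrates on ordinals that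
carry none. -/
theorem IsNormalUF.exists_orderZero {δ : ZFSet.{u}} (hδ : δ.IsOrdinal)
    (h : ∃ l, IsNormalUF δ l) :
    ∃ l, IsNormalUF δ l ∧ ∀ᶠ ζ in l, ¬ ∃ w, IsNormalUF ζ w := by
  induction δ using ZFSet.inductionOn with
  | _ δ ih =>
  obtain ⟨l, hl⟩ := h
  by_cases h0 : ∀ᶠ ζ in l, ¬ ∃ w, IsNormalUF ζ w
  · exact ⟨l, hl, h0⟩
  rw [Ultrafilter.eventually_not, not_not] at h0
  have : ∀ᶠ ζ in l, ∃ w, IsNormalUF ζ w ∧ ∀ᶠ η in w, ¬ ∃ w', IsNormalUF η w' := by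
    filter_upwards [h0, hl.mem] with ζ h1 h2
    exact ih ζ h2 (hδ.mem h2) h1
  obtain ⟨w, hw⟩ := this.choice
  have hb : ∀ P : ZFSet.{u} → Prop, (∀ᶠ η in l.bind w, P η) ↔ ∀ᶠ ζ in l, ∀ᶠ η in w ζ, P η :=
    fun P => Iff.rfl
  -- Average the order-zero ultrafilters `w ζ` over `l`. A regressive f is constant modulo `w ζ`
  -- with a value `g ζ` ∈ ζ, and g is then regressive modulo `l`.
  refine ⟨l.bind w, ⟨?_, fun γ hγ => ?_, fun f hf => ?_⟩, ?_⟩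
  · rw [hb]
    filter_upwards [hw, hl.mem] with ζ h1 h2
    exact h1.1.mem.mono fun η hη => hδ.mem_trans hη h2
  · rw [hb]
    filter_upwards [hw, hl.tail γ hγ] with ζ h1 h2 using h1.1.tail γ h2
  · rw [hb] at hf
    have : ∀ᶠ ζ in l, ∃ γ, γ ∈ ζ ∧ ∀ᶠ η in w ζ, f η = γ := by
      filter_upwards [hw, hf, hl.mem] with ζ h1 h2 h3
      obtain ⟨γ, hγ⟩ := h1.1.normal f h2
      obtain ⟨η, h4, h5, h6⟩ := (hγ.and (h2.and h1.1.mem)).exists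
      exact ⟨γ, (hδ.mem h3).mem_trans (h4 ▸ h5) h6, hγ⟩
    obtain ⟨g, hg⟩ := this.choice
    obtain ⟨γ, hγ⟩ := hl.normal g (hg.mono fun ζ hζ => hζ.1)
    refine ⟨γ, ?_⟩
    rw [hb]
    filter_upwards [hg, hγ] with ζ h1 h2
    rw [← h2]
    exact h1.2
  · rw [hb]
    exact hw.mono fun ζ hζ => hζ.2

/-! ### Normal ultrafilters represented in an ultrapower -/

/-- If `F` represents a normal ultrafilter `k` on `δ` in the ultrapower by the normal ultrafilter
`l`, then almost all values of `F` are normal ultrafilters. -/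
theorem IsNormalUF.eventually_exists_of_represents {δ : ZFSet.{u}} (hδ : δ.IsOrdinal)
    {l k : Ultrafilter ZFSet.{u}} (hl : IsNormalUF δ l) (hk : IsNormalUF δ k)
    (F : ZFSet.{u} → ZFSet.{u})
    (hF : ∀ A ⊆ δ, (∀ᶠ γ in k, γ ∈ A) ↔ ∀ᶠ ζ in l, A ∩ ζ ∈ F ζ) :
    ∀ᶠ ζ in l, ∃ w, IsNormalUF ζ w := by
  -- A Łoś principle for `F`. By diagonal intersection, a family of subsets of the ζ's agrees almost
  -- everywhere with A ∩ ζ for a single A ⊆ δ, to which `hF` applies.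
  have key : ∀ p : ZFSet.{u} → ZFSet.{u} → Prop,
      (∀ᶠ ζ in l, ζ.sep (p ζ) ∈ F ζ) ↔ ∀ᶠ γ in k, ∀ᶠ ζ in l, p ζ γ := by
    intro p
    let A : ZFSet.{u} := δ.sep fun γ => ∀ᶠ ζ in l, p ζ γ
    have hA : ∀ᶠ ζ in l, A ∩ ζ = ζ.sep (p ζ) := by
      have : ∀ᶠ ζ in l, ∀ γ ∈ ζ, (γ ∈ A ↔ p ζ γ) := by
        refine hl.diagonal hδ fun γ hγ => ?_
        by_cases hp : ∀ᶠ ζ in l, p ζ γ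
        · filter_upwards [hp] with ζ hζ
          simp [A, hγ, hp, hζ]
        · have hp' := Ultrafilter.eventually_not.2 hp
          filter_upwards [hp'] with ζ hζ
          simp [A, hp, hζ]
      filter_upwards [this] with ζ hζ
      ext γ
      rw [ZFSet.mem_inter, and_comm, ZFSet.mem_sep (x := ζ)]
      exact and_congr_right fun h => hζ γ h
    have h1 : (∀ᶠ ζ in l, ζ.sep (p ζ) ∈ F ζ) ↔ ∀ᶠ ζ in l, A ∩ ζ ∈ F ζ :=
      eventually_congr (hA.mono fun ζ hζ => by rw [hζ])
    rw [h1, ← hF A ZFSet.sep_subset]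
    refine eventually_congr (hk.mem.mono fun γ hγ => ?_)
    simp [A, hγ]
  -- It suffices to refute one simultaneous choice of counterexamples; this turns each statement
  -- about all subsets of ζ into one about a family to which `key` applies.
  have contra : ∀ {Q : ZFSet.{u} → (ZFSet.{u} → ZFSet.{u}) → Prop},
      (∀ p : ZFSet.{u} → ZFSet.{u} → ZFSet.{u}, ¬ ∀ᶠ ζ in l, ¬ Q ζ (p ζ)) →
        ∀ᶠ ζ in l, ∀ p, Q ζ p := by
    intro Q hQ
    by_contra hne
    rw [← Ultrafilter.eventually_not] at hne
    have : ∀ᶠ ζ in l, ∃ p, ¬ Q ζ p := hne.mono fun ζ hζ => by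
      push Not at hζ
      exact hζ
    obtain ⟨p, hp⟩ := this.choice
    exact hQ p hp
  have contra' : ∀ {Q : ZFSet.{u} → (ZFSet.{u} → Prop) → Prop},
      (∀ p : ZFSet.{u} → ZFSet.{u} → Prop, ¬ ∀ᶠ ζ in l, ¬ Q ζ (p ζ)) →
        ∀ᶠ ζ in l, ∀ p, Q ζ p := by
    intro Q hQ
    by_contra hne
    rw [← Ultrafilter.eventually_not] at hne
    have : ∀ᶠ ζ in l, ∃ p, ¬ Q ζ p := hne.mono fun ζ hζ => by
      push Not at hζ
      exact hζ
    obtain ⟨p, hp⟩ := this.choice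
    exact hQ p hp
  have g0 : ∀ᶠ ζ in l, ζ.sep (fun _ => True) ∈ F ζ := by
    rw [key fun _ _ => True]
    simp
  have g1 : ∀ᶠ ζ in l, ∀ p q : ZFSet.{u} → Prop, ζ.sep p ∈ F ζ → (∀ γ ∈ ζ, p γ → q γ) →
      ζ.sep q ∈ F ζ := by
    refine contra' fun p hp => ?_
    simp only [not_forall] at hp
    obtain ⟨q, hq⟩ := hp.choice
    have h1 := (key p).1 (hq.mono fun ζ hζ => hζ.1)
    have h2 : ∀ᶠ ζ in l, ζ.sep (q ζ) ∈ F ζ := by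
      rw [key]
      filter_upwards [h1, hk.mem] with γ h3 h4
      filter_upwards [h3, hq, hl.tail γ h4] with ζ h5 h6 h7
      exact h6.2.1 γ h7 h5
    obtain ⟨ζ, h3, h4⟩ := (hq.and h2).exists
    exact h3.2.2 h4
  have g2 : ∀ᶠ ζ in l, ∀ p q : ZFSet.{u} → Prop, ζ.sep p ∈ F ζ → ζ.sep q ∈ F ζ →
      ζ.sep (fun γ => p γ ∧ q γ) ∈ F ζ := by
    refine contra' fun p hp => ?_
    simp only [not_forall] at hp
    obtain ⟨q, hq⟩ := hp.choice
    have h1 := (key p).1 (hq.mono fun ζ hζ => hζ.1)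
    have h2 := (key q).1 (hq.mono fun ζ hζ => hζ.2.1)
    have h2 : ∀ᶠ ζ in l, ζ.sep (fun γ => p ζ γ ∧ q ζ γ) ∈ F ζ := by
      rw [key fun ζ γ => p ζ γ ∧ q ζ γ]
      filter_upwards [h1, h2] with γ h3 h4 using h3.and h4
    obtain ⟨ζ, h3, h4⟩ := (hq.and h2).exists
    exact h3.2.2 h4
  have g3 : ∀ᶠ ζ in l, ∀ p : ZFSet.{u} → Prop,
      ζ.sep (fun γ => ¬ p γ) ∉ F ζ ↔ ζ.sep p ∈ F ζ := by
    refine contra' fun p hp => ?_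
    have h1 : (∀ᶠ ζ in l, ζ.sep (fun γ => ¬ p ζ γ) ∈ F ζ) ↔ ¬ ∀ᶠ ζ in l, ζ.sep (p ζ) ∈ F ζ := by
      rw [key p, key fun ζ γ => ¬ p ζ γ, ← Ultrafilter.eventually_not]
      simp only [Ultrafilter.eventually_not]
    by_cases h2 : ∀ᶠ ζ in l, ζ.sep (p ζ) ∈ F ζ
    · have h3 := Ultrafilter.eventually_not.2 (fun h => (h1.1 h) h2)
      obtain ⟨ζ, h4, h5, h6⟩ := (hp.and (h2.and h3)).exists
      exact h4 ⟨fun _ => h5, fun _ => h6⟩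
    · have h3 := h1.2 h2
      obtain ⟨ζ, h4, h5, h6⟩ := (hp.and ((Ultrafilter.eventually_not.2 h2).and h3)).exists
      exact h4 ⟨fun h => absurd h6 h, fun h => absurd h h5⟩
  have g4 : ∀ᶠ ζ in l, ∀ γ ∈ ζ, ζ.sep (fun η => γ ∈ η) ∈ F ζ := by
    refine hl.diagonal hδ fun γ hγ => ?_
    rw [key fun _ η => γ ∈ η]
    filter_upwards [hk.tail γ hγ] with η hη
    simp [hη]
  have g5 : ∀ᶠ ζ in l, ∀ f : ZFSet.{u} → ZFSet.{u}, ζ.sep (fun η => f η ∈ η) ∈ F ζ →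
      ∃ γ, ζ.sep (fun η => f η = γ) ∈ F ζ := by
    refine contra fun f hf => ?_
    simp only [not_forall, not_exists] at hf
    have h1 := (key fun ζ η => f ζ η ∈ η).1 (hf.mono fun ζ hζ => hζ.1)
    -- For fixed η the values f ζ η ∈ η ∈ ζ are regressive in ζ, so normality of `l` makes them
    -- constant. The constants are regressive in η, so normality of `k` applies next.
    have h2 : ∀ᶠ η in k, ∃ γ, γ ∈ η ∧ ∀ᶠ ζ in l, f ζ η = γ := by
      filter_upwards [h1, hk.mem] with η h3 h4
      obtain ⟨γ, hγ⟩ := hl.normal (fun ζ => f ζ η) (by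
        filter_upwards [h3, hl.tail η h4, hl.mem] with ζ h5 h6 h7
        exact (hδ.mem h7).mem_trans h5 h6)
      obtain ⟨ζ, h5, h6⟩ := (hγ.and h3).exists
      exact ⟨γ, h5 ▸ h6, hγ⟩
    obtain ⟨g, hg⟩ := h2.choice
    obtain ⟨γ, hγ⟩ := hk.normal g (hg.mono fun η hη => hη.1)
    have h3 : ∀ᶠ ζ in l, ζ.sep (fun η => f ζ η = γ) ∈ F ζ := by
      rw [key fun ζ η => f ζ η = γ]
      filter_upwards [hg, hγ] with η h4 h5
      rw [← h5]
      exact h4.2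
    obtain ⟨ζ, h4, h5⟩ := (hf.and h3).exists
    exact h4.2 γ h5
  filter_upwards [g0, g1, g2, g3, g4, g5] with ζ g0 g1 g2 g3 g4 g5
  let w : Ultrafilter ZFSet.{u} := Ultrafilter.ofComplNotMemIff
    { sets := {A | ζ.sep (· ∈ A) ∈ F ζ}
      univ_sets := g0
      sets_of_superset := fun {A B} hA hAB => g1 (· ∈ A) (· ∈ B) hA fun γ _ h => hAB h
      inter_sets := fun {A B} hA hB => g2 (· ∈ A) (· ∈ B) hA hB }
    (fun A => g3 (· ∈ A))
  have hw : ∀ p : ZFSet.{u} → Prop, (∀ᶠ γ in w, p γ) ↔ ζ.sep p ∈ F ζ := fun _ => Iff.rfl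
  refine ⟨w, (hw _).2 ?_, fun γ hγ => (hw _).2 (g4 γ hγ), fun f hf => ?_⟩
  · exact g1 _ _ g0 fun γ hγ _ => hγ
  · obtain ⟨γ, hγ⟩ := g5 f ((hw _).1 hf)
    exact ⟨γ, (hw _).2 hγ⟩

/-! ### Functions of finitely many coordinates -/

section Support

variable {C : Type w} {α β γ : Type*} {T T' : Set C}

/-- The function `F` depends on finitely many coordinates, all of them in `T`. -/
def Supp (T : Set C) (F : (C → ZFSet.{u}) → α) : Prop :=
  ∃ s : Finset C, (s : Set C) ⊆ T ∧ DependsOn F (s : Set C)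

theorem Supp.mono {F : (C → ZFSet.{u}) → α} (h : Supp T F) (hT : T ⊆ T') : Supp T' F := by
  obtain ⟨s, hs, hF⟩ := h
  exact ⟨s, hs.trans hT, hF⟩

theorem Supp.const (a : α) : Supp T (fun _ : C → ZFSet.{u} => a) :=
  ⟨∅, by simp, fun _ _ _ => rfl⟩

theorem Supp.coord {c : C} (hc : c ∈ T) : Supp T (fun x : C → ZFSet.{u} => x c) :=
  ⟨{c}, by simpa using hc, fun _ _ h => h c (by simp)⟩

theorem Supp.comp {F : (C → ZFSet.{u}) → α} (h : Supp T F) (g : α → β) :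
    Supp T (fun x => g (F x)) := by
  obtain ⟨s, hs, hF⟩ := h
  exact ⟨s, hs, fun x y hxy => congrArg g (hF hxy)⟩

theorem Supp.comp₂ {F : (C → ZFSet.{u}) → α} {H : (C → ZFSet.{u}) → β} (hF : Supp T F)
    (hH : Supp T H) (g : α → β → γ) : Supp T (fun x => g (F x) (H x)) := by
  classical
  obtain ⟨s, hs, hF⟩ := hF
  obtain ⟨t, ht, hH⟩ := hH
  refine ⟨s ∪ t, by simp [hs, ht], fun x y hxy => ?_⟩
  have h1 : F x = F y := hF fun i hi => hxy i (by simp at hi; simp [hi])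
  have h2 : H x = H y := hH fun i hi => hxy i (by simp at hi; simp [hi])
  simp only [h1, h2]

/-- This turns a function on `insert c T` into a function on T whose values are functions of the
coordinate c, the form needed to represent elements of an ultrapower. -/
theorem Supp.curry [DecidableEq C] {c : C} {F : (C → ZFSet.{u}) → α} (h : Supp (insert c T) F) :
    Supp T (fun x ζ => F (Function.update x c ζ)) := by
  obtain ⟨s, hs, hF⟩ := h
  refine ⟨s.erase c, fun d hd => ?_, fun x y hxy => funext fun ζ => hF fun i hi => ?_⟩
  · simp only [Finset.coe_erase, Set.mem_sdiff, Set.mem_singleton_iff] at hd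
    exact (hs hd.1).resolve_left hd.2
  · rcases eq_or_ne i c with rfl | hne
    · simp
    · simp only [Function.update_of_ne hne]
      exact hxy i (by simpa using ⟨hi, hne⟩)

theorem Supp.update_of_notMem [DecidableEq C] {c : C} {F : (C → ZFSet.{u}) → α} (h : Supp T F)
    (hc : c ∉ T) (x : C → ZFSet.{u}) (ζ : ZFSet.{u}) : F (Function.update x c ζ) = F x := by
  obtain ⟨s, hs, hF⟩ := h
  exact hF fun i hi => Function.update_of_ne (ne_of_mem_of_not_mem (hs hi) hc) _ _

theorem Supp.empty {F : (C → ZFSet.{u}) → α} (h : Supp ∅ F) (x y : C → ZFSet.{u}) : F x = F y := by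
  obtain ⟨s, hs, hF⟩ := h
  exact hF fun i hi => absurd (hs hi) (Set.notMem_empty i)

theorem Supp.reindex {ρ : C → C} {F : (C → ZFSet.{u}) → α} (h : Supp T F) (hρ : Set.MapsTo ρ T T') :
    Supp T' (fun x => F (x ∘ ρ)) := by
  classical
  obtain ⟨s, hs, hF⟩ := h
  refine ⟨s.image ρ, ?_, fun x y hxy => hF fun i hi => hxy _ (by simpa using ⟨i, hi, rfl⟩)⟩
  rw [Finset.coe_image]
  rintro _ ⟨i, hi, rfl⟩
  exact hρ (hs hi)

end Support

theorem IsMeasure.card_eq {κ κ' : Cardinal.{u}} {W : ZFSet.{u}} (h : IsMeasure κ W)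
    (h' : IsMeasure κ' W) : κ = κ' :=
  Cardinal.ord_injective (Ordinal.toZFSet_injective (h.sUnion_eq.symm.trans h'.sUnion_eq))

/-! ### Commuting ultrafilters -/

/-- Two ultrafilters commute if iterated quantifiers over them can be interchanged. -/
def UFCommute (l m : Ultrafilter ZFSet.{u}) : Prop :=
  ∀ P : ZFSet.{u} → ZFSet.{u} → Prop,
    (∀ᶠ y in l, ∀ᶠ z in m, P y z) ↔ ∀ᶠ z in m, ∀ᶠ y in l, P y z

theorem UFCommute.symm {l m : Ultrafilter ZFSet.{u}} (h : UFCommute l m) :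
    UFCommute m l :=
  fun P => (h fun y z => P z y).symm

/-- For each y in the small set B the quantifier over `m` is decided, and completeness of `m`
realizes all these decisions at a single z. The converse follows by negating P. -/
theorem ufCommute_of_card_lt {l m : Ultrafilter ZFSet.{u}} {B : ZFSet.{u}}
    {κ : Cardinal.{u}} (hl : ∀ᶠ y in l, y ∈ B) (hB : B.card < κ) (hm : CompleteBelow m κ) :
    UFCommute l m := by
  have main : ∀ P : ZFSet.{u} → ZFSet.{u} → Prop,
      (∀ᶠ y in l, ∀ᶠ z in m, P y z) → ∀ᶠ z in m, ∀ᶠ y in l, P y z := by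
    intro P h
    have := hm B hB (fun y z => (∀ᶠ z in m, P y z) → P y z) fun y _ => by
      by_cases hy : ∀ᶠ z in m, P y z
      · exact hy.mono fun z hz _ => hz
      · exact Eventually.of_forall fun z hz => absurd hz hy
    filter_upwards [this] with z hz
    filter_upwards [h, hl] with y h1 h2 using hz y h2 h1
  refine fun P => ⟨main P, fun h => ?_⟩
  by_contra hne
  rw [← Ultrafilter.eventually_not] at hne
  simp only [← Ultrafilter.eventually_not] at hne
  have := main (fun y z => ¬ P y z) hne
  obtain ⟨z, h1, h2⟩ := (h.and this).exists
  obtain ⟨y, h3, h4⟩ := (h1.and h2).exists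
  exact h4 h3

/-! ### Systems of measures and their iterated filter -/

/-- A system of normal measures with index set `C`, each depending on finitely many earlier
coordinates. -/
structure System (C : Type w) [LinearOrder C] where
  card : C → (C → ZFSet.{u}) → Cardinal.{u}
  W : C → (C → ZFSet.{u}) → ZFSet.{u}
  normal : ∀ c x, IsNormalMeasure (card c x) (W c x)
  dep : C → Finset C
  dep_lt : ∀ c, ∀ d ∈ dep c, d < c
  W_dep : ∀ c, DependsOn (W c) (dep c : Set C)
  bound : Cardinal.{u}
  card_le : ∀ c x, card c x ≤ bound

namespace System

variable {C : Type w} [LinearOrder C] (S : System.{u} C)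

/-- The ultrafilter at the coordinate `c`. -/
noncomputable def meas (c : C) (x : C → ZFSet.{u}) : Ultrafilter ZFSet.{u} :=
  (S.normal c x).toIsMeasure.uf

/-- The cardinal at the coordinate `c`, as a set. -/
noncomputable def cardSet (c : C) (x : C → ZFSet.{u}) : ZFSet.{u} := (S.card c x).ord.toZFSet

theorem sUnion_W (c : C) (x : C → ZFSet.{u}) : (ZFSet.sUnion (S.W c x)) = S.cardSet c x :=
  (S.normal c x).toIsMeasure.sUnion_eq

theorem isNormalUF (c : C) (x : C → ZFSet.{u}) : IsNormalUF (S.cardSet c x) (S.meas c x) :=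
  (S.normal c x).isNormalUF

theorem completeBelow (c : C) (x : C → ZFSet.{u}) : CompleteBelow (S.meas c x) (S.card c x) :=
  (S.normal c x).toIsMeasure.completeBelow

theorem isOrdinal_cardSet (c : C) (x : C → ZFSet.{u}) : (S.cardSet c x).IsOrdinal :=
  ZFSet.isOrdinal_toZFSet _

theorem mem_W_iff {c : C} {x : C → ZFSet.{u}} {A : ZFSet.{u}} (hA : A ⊆ S.cardSet c x) :
    A ∈ S.W c x ↔ ∀ᶠ ζ in S.meas c x, ζ ∈ A :=
  (S.normal c x).toIsMeasure.mem_iff hA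

instance (c : C) (x : C → ZFSet.{u}) :
    CountableInterFilter (S.meas c x : Filter ZFSet.{u}) :=
  (S.completeBelow c x).countableInterFilter (S.normal c x).uncountable

/-- A measure determines its cardinal as its union. So `W_dep` also controls the cardinal and the
ultrafilter. -/
theorem card_eq_of_W_eq {c d : C} {x y : C → ZFSet.{u}} (h : S.W c x = S.W d y) :
    S.card c x = S.card d y :=
  (S.normal c x).toIsMeasure.card_eq (h ▸ (S.normal d y).toIsMeasure)

theorem meas_eq_of_W_eq {c d : C} {x y : C → ZFSet.{u}} (h : S.W c x = S.W d y) :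
    S.meas c x = S.meas d y := by
  have hc := S.card_eq_of_W_eq h
  ext A
  change (∀ᶠ z in (S.normal c x).toIsMeasure.uf, z ∈ A) ↔
    ∀ᶠ z in (S.normal d y).toIsMeasure.uf, z ∈ A
  rw [IsMeasure.eventually_iff, IsMeasure.eventually_iff, h, hc]

theorem supp_W {c : C} {T : Set C} (h : (S.dep c : Set C) ⊆ T) : Supp T (S.W c) :=
  ⟨S.dep c, h, S.W_dep c⟩

theorem supp_meas {c : C} {T : Set C} (h : (S.dep c : Set C) ⊆ T) : Supp T (S.meas c) :=
  ⟨S.dep c, h, fun _ _ hxy => S.meas_eq_of_W_eq (S.W_dep c hxy)⟩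

theorem supp_card {c : C} {T : Set C} (h : (S.dep c : Set C) ⊆ T) : Supp T (S.card c) :=
  ⟨S.dep c, h, fun _ _ hxy => S.card_eq_of_W_eq (S.W_dep c hxy)⟩

theorem supp_cardSet {c : C} {T : Set C} (h : (S.dep c : Set C) ⊆ T) : Supp T (S.cardSet c) :=
  (S.supp_card h).comp fun κ => κ.ord.toZFSet

theorem coe_dep_subset (c : C) : (S.dep c : Set C) ⊆ Set.Iio c := fun d hd => S.dep_lt c d hd

/-- A choice of sets of measure one at all coordinates, depending on the earlier coordinates. -/
structure Strategy (σ : C → (C → ZFSet.{u}) → Set ZFSet.{u}) : Prop where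
  mem : ∀ c x, σ c x ∈ S.meas c x
  dep : ∀ c, DependsOn (σ c) (Set.Iio c)

/-- The filter of iterated measure one sets. -/
def filter : Filter (C → ZFSet.{u}) where
  sets := {A | ∃ σ, S.Strategy σ ∧ ∀ x, (∀ c, x c ∈ σ c x) → x ∈ A}
  univ_sets := ⟨fun _ _ => Set.univ, ⟨fun _ _ => univ_mem, fun _ _ _ _ => rfl⟩, by simp⟩
  sets_of_superset := fun ⟨σ, hσ, h⟩ hAB => ⟨σ, hσ, fun x hx => hAB (h x hx)⟩
  inter_sets := fun ⟨σ, hσ, h⟩ ⟨τ, hτ, h'⟩ =>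
    ⟨fun c x => σ c x ∩ τ c x, ⟨fun c x => inter_mem (hσ.mem c x) (hτ.mem c x),
      fun c x y hxy => by simp only [hσ.dep c hxy, hτ.dep c hxy]⟩,
      fun x hx => ⟨h x fun c => (hx c).1, h' x fun c => (hx c).2⟩⟩

theorem mem_filter {A : Set (C → ZFSet.{u})} :
    A ∈ S.filter ↔ ∃ σ, S.Strategy σ ∧ ∀ x, (∀ c, x c ∈ σ c x) → x ∈ A := Iff.rfl

instance : CountableInterFilter S.filter := by
  refine ⟨fun 𝒜 h𝒜 hA => ?_⟩
  choose! σ hσ hσA using fun A hA' => S.mem_filter.1 (hA A hA')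
  refine S.mem_filter.2 ⟨fun c x => ⋂ A ∈ 𝒜, σ A c x, ⟨fun c x => ?_, fun c x y hxy => ?_⟩, ?_⟩
  · exact (countable_bInter_mem (l := (S.meas c x : Filter ZFSet.{u})) h𝒜).2
      fun A hA' => (hσ A hA').mem c x
  · exact Set.iInter₂_congr fun A hA' => (hσ A hA').dep c hxy
  · intro x hx A hA'
    exact hσA A hA' x fun c => Set.mem_iInter₂.1 (hx c) A hA'

theorem eventually_coord (c : C) {P : (C → ZFSet.{u}) → ZFSet.{u} → Prop}
    (hP : DependsOn P (Set.Iio c)) (h : ∀ x, ∀ᶠ ζ in S.meas c x, P x ζ) :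
    ∀ᶠ x in S.filter, P x (x c) := by
  classical
  refine S.mem_filter.2 ⟨fun d x => if d = c then {ζ | P x ζ} else Set.univ,
    ⟨fun d x => ?_, fun d x y hxy => ?_⟩, fun x hx => by simpa using hx c⟩
  · split_ifs with hd
    · subst hd; exact h x
    · exact univ_mem
  · split_ifs with hd
    · subst hd; simp only [hP hxy]
    · rfl

theorem eventually_of_fubini {c : C} {P : (C → ZFSet.{u}) → Prop} (hP : DependsOn P (Set.Iic c))
    (h : ∀ᶠ x in S.filter, ∀ᶠ ζ in S.meas c x, P (Function.update x c ζ)) :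
    ∀ᶠ x in S.filter, P x := by
  have hdep : DependsOn (fun x ζ => P (Function.update x c ζ)) (Set.Iio c) := by
    refine fun x y hxy => funext fun ζ => hP fun i hi => ?_
    rcases eq_or_lt_of_le hi with rfl | hlt
    · simp
    · simp only [Function.update_of_ne hlt.ne]
      exact hxy i hlt
  -- The implication makes the condition large at every x, as `eventually_coord` requires, and not
  -- only at almost every x.
  have := S.eventually_coord c (P := fun x ζ =>
      (∀ᶠ ζ in S.meas c x, P (Function.update x c ζ)) → P (Function.update x c ζ)) (by
    intro x y hxy
    have h1 := congrFun (hdep hxy)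
    have h2 := S.meas_eq_of_W_eq (S.W_dep c fun i hi => hxy i (S.dep_lt c i hi))
    funext ζ
    simp only at h1
    simp only [h1, h2]) (fun x => by
    by_cases hx : ∀ᶠ ζ in S.meas c x, P (Function.update x c ζ)
    · exact hx.mono fun ζ hζ _ => hζ
    · exact Eventually.of_forall fun ζ hζ => absurd hζ hx)
  filter_upwards [h, this] with x h1 h2
  simpa using h2 h1

theorem supp_fubini {c : C} {T : Set C} (hT : (S.dep c : Set C) ⊆ T)
    {P : (C → ZFSet.{u}) → Prop} (hP : Supp (insert c T) P) :
    Supp T (fun x => ∀ᶠ ζ in S.meas c x, P (Function.update x c ζ)) :=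
  (S.supp_meas hT).comp₂ hP.curry fun l p => ∀ᶠ ζ in (l : Filter ZFSet.{u}), p ζ

/-! ### Resampling and ultrafilter behaviour -/

/-- Resampling the coordinate `c` does not change the measure of sets with support in
`insert c T`. -/
def Resamp (c : C) (T : Set C) : Prop :=
  ∀ P : (C → ZFSet.{u}) → Prop, Supp (insert c T) P →
    ((∀ᶠ x in S.filter, P x) ↔
      ∀ᶠ x in S.filter, ∀ᶠ ζ in S.meas c x, P (Function.update x c ζ))

theorem Resamp.mono {S : System.{u} C} {c : C} {T T' : Set C} (h : S.Resamp c T') (hT : T ⊆ T') :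
    S.Resamp c T :=
  fun P hP => h P (hP.mono (Set.insert_subset_insert hT))

theorem Resamp.eventually_coord {S : System.{u} C} {c : C} {T : Set C} (h : S.Resamp c T)
    {P : (C → ZFSet.{u}) → ZFSet.{u} → Prop} (hP : Supp T P) (hc : c ∉ T) :
    (∀ᶠ x in S.filter, P x (x c)) ↔ ∀ᶠ x in S.filter, ∀ᶠ ζ in S.meas c x, P x ζ := by
  rw [h (fun x => P x (x c))]
  · simp only [hP.update_of_notMem hc, Function.update_self]
  · exact (hP.mono (Set.subset_insert _ _)).comp₂ (Supp.coord (Set.mem_insert _ _))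
      fun p ζ => p ζ

section WellFounded

variable [WellFoundedLT C]

/-- Recursion along C builds a point that obeys a given strategy. The default ∅ at coordinates not
yet built is harmless, since `σ c` sees only coordinates below c. -/
instance : S.filter.NeBot := by
  refine ⟨fun hbot => ?_⟩
  obtain ⟨σ, hσ, h⟩ := S.mem_filter.1 (hbot ▸ mem_bot : (∅ : Set (C → ZFSet.{u})) ∈ S.filter)
  classical
  let step : ∀ c : C, (∀ d, d < c → ZFSet.{u}) → ZFSet.{u} := fun c r =>
    Classical.choose ((S.meas c fun d => if h : d < c then r d h else ∅).nonempty_of_mem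
      (hσ.mem c fun d => if h : d < c then r d h else ∅))
  let x : C → ZFSet.{u} := (wellFounded_lt (α := C)).fix step
  have hx : ∀ c, x c ∈ σ c x := by
    intro c
    have h1 : x c = step c fun d _ => x d := (wellFounded_lt (α := C)).fix_eq step c
    have h2 : σ c x = σ c fun d => if _ : d < c then x d else ∅ :=
      hσ.dep c fun d (hd : d < c) => by simp [hd]
    rw [h1, h2]
    exact Classical.choose_spec ((S.meas c fun d => if h : d < c then x d else ∅).nonempty_of_mem
      (hσ.mem c fun d => if h : d < c then x d else ∅))
  exact h x hx

/-- Induction on the largest coordinate c of the support: quantifying over c leaves a property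
supported below c, and the ultrafilter at c decides the rest. -/
theorem em_of_supp {T : Set C} {P : (C → ZFSet.{u}) → Prop} (hP : Supp T P) :
    (∀ᶠ x in S.filter, P x) ∨ ∀ᶠ x in S.filter, ¬ P x := by
  have base : ∀ P : (C → ZFSet.{u}) → Prop, Supp ∅ P →
      (∀ᶠ x in S.filter, P x) ∨ ∀ᶠ x in S.filter, ¬ P x := fun P hP => by
    by_cases h : P fun _ => ∅
    · exact Or.inl (Eventually.of_forall fun x => hP.empty (fun _ => ∅) x ▸ h)
    · exact Or.inr (Eventually.of_forall fun x => hP.empty (fun _ => ∅) x ▸ h)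
  have cover : ∀ {U : Set C} {P : (C → ZFSet.{u}) → Prop}, Supp U P →
      Supp ∅ P ∨ ∃ c ∈ U, Supp (Set.Iic c) P := by
    rintro U P ⟨s, hs, hP⟩
    rcases s.eq_empty_or_nonempty with rfl | hne
    · exact Or.inl ⟨∅, by simp, hP⟩
    · exact Or.inr ⟨s.max' hne, hs (s.max'_mem hne), s, fun d hd => s.le_max' d hd, hP⟩
  have main : ∀ c, ∀ P : (C → ZFSet.{u}) → Prop, Supp (Set.Iic c) P →
      (∀ᶠ x in S.filter, P x) ∨ ∀ᶠ x in S.filter, ¬ P x := by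
    intro c
    induction c using WellFoundedLT.induction with
    | _ c ih =>
    intro P hP
    have hdep : DependsOn P (Set.Iic c) := by
      obtain ⟨s, hs, h⟩ := hP
      exact h.mono hs
    have hP' : Supp (insert c (Set.Iio c)) P := hP.mono (by rw [Set.Iio_insert])
    have hQ := S.supp_fubini (S.coe_dep_subset c) hP'
    have : (∀ᶠ x in S.filter, ∀ᶠ ζ in S.meas c x, P (Function.update x c ζ)) ∨
        ∀ᶠ x in S.filter, ¬ ∀ᶠ ζ in S.meas c x, P (Function.update x c ζ) := by
      rcases cover hQ with h | ⟨d, hd, h⟩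
      · exact base _ h
      · exact ih d hd _ h
    rcases this with h | h
    · exact Or.inl (S.eventually_of_fubini hdep h)
    · refine Or.inr (S.eventually_of_fubini (c := c) (P := fun x => ¬ P x)
        (fun x y hxy => by simp only [hdep hxy]) (h.mono fun x hx => ?_))
      exact Ultrafilter.eventually_not.2 hx
  rcases cover hP with h | ⟨c, -, h⟩
  · exact base _ h
  · exact main c _ h

theorem eventually_not {T : Set C} {P : (C → ZFSet.{u}) → Prop} (hP : Supp T P) :
    (∀ᶠ x in S.filter, ¬ P x) ↔ ¬ ∀ᶠ x in S.filter, P x := by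
  refine ⟨fun h h' => ?_, fun h => (S.em_of_supp hP).resolve_left h⟩
  obtain ⟨x, h1, h2⟩ := (h.and h').exists
  exact h1 h2

/-- The other direction is the same implication for ¬P, because both sides are decided by the
filter. -/
theorem resamp_of_imp {c : C} {T : Set C}
    (h : ∀ P : (C → ZFSet.{u}) → Prop, Supp (insert c T) P →
      (∀ᶠ x in S.filter, ∀ᶠ ζ in S.meas c x, P (Function.update x c ζ)) →
        ∀ᶠ x in S.filter, P x) : S.Resamp c T := by
  refine fun P hP => ⟨fun h1 => ?_, h P hP⟩
  have hQ := S.supp_fubini (Set.subset_univ _) (hP.mono (Set.insert_subset_insert (Set.subset_univ T)))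
  by_contra h2
  rw [← S.eventually_not hQ] at h2
  have := h (fun x => ¬ P x) (hP.comp Not) (h2.mono fun x hx => Ultrafilter.eventually_not.2 hx)
  obtain ⟨x, h3, h4⟩ := (h1.and this).exists
  exact h4 h3

theorem resamp_of_lt {c : C} {T : Set C} (hT : ∀ d ∈ T, d < c) : S.Resamp c T :=
  S.resamp_of_imp fun P hP h => by
    obtain ⟨s, hs, hP⟩ := hP
    refine S.eventually_of_fubini (hP.mono fun d hd => ?_) h
    rcases hs hd with rfl | hd'
    · exact le_rfl
    · exact (hT d hd').le

/-- Induction on a bound d for the support. If c < d, quantify over d first; commutation moves the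
quantifier over c outside it, and the resulting property is supported below d. -/
theorem resamp_univ {c : C} (hdep : ∀ d, c < d → c ∉ S.dep d)
    (hcomm : ∀ d, c < d → ∀ᶠ x in S.filter, UFCommute (S.meas d x) (S.meas c x)) :
    S.Resamp c Set.univ := by
  have main : ∀ d, ∀ P : (C → ZFSet.{u}) → Prop, Supp (Set.Iic d) P →
      (∀ᶠ x in S.filter, ∀ᶠ ζ in S.meas c x, P (Function.update x c ζ)) →
        ∀ᶠ x in S.filter, P x := by
    intro d
    induction d using WellFoundedLT.induction with
    | _ d ih =>
    intro P hP h
    have hdP : DependsOn P (Set.Iic d) := by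
      obtain ⟨s, hs, h⟩ := hP
      exact h.mono hs
    rcases lt_trichotomy c d with hcd | rfl | hdc
    · have hP' : Supp (insert d (Set.Iio d)) P := hP.mono (by rw [Set.Iio_insert])
      have hQ' := S.supp_fubini (S.coe_dep_subset d) hP'
      refine S.eventually_of_fubini hdP ?_
      set Q : (C → ZFSet.{u}) → Prop := fun x => ∀ᶠ y in S.meas d x, P (Function.update x d y)
      have hupd : ∀ x ζ, S.meas d (Function.update x c ζ) = S.meas d x := fun x ζ =>
        (S.supp_meas (le_refl (S.dep d : Set C))).update_of_notMem (hdep d hcd) x ζ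
      have hupc : ∀ x ζ, S.meas c (Function.update x d ζ) = S.meas c x := fun x ζ =>
        (S.supp_meas (S.coe_dep_subset c)).update_of_notMem
          (fun h => lt_asymm hcd (Set.mem_Iio.1 h)) x ζ
      have hQ : ∀ᶠ x in S.filter, ∀ᶠ ζ in S.meas c x, Q (Function.update x c ζ) := by
        have h1 : ∀ᶠ x in S.filter, ∀ᶠ y in S.meas d x, ∀ᶠ ζ in S.meas c x,
            P (Function.update (Function.update x d y) c ζ) := by
          have hs : Supp (insert d (Set.Iio d))
              (fun x => ∀ᶠ ζ in S.meas c x, P (Function.update x c ζ)) := by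
            refine S.supp_fubini (fun i hi => Or.inr ((S.dep_lt c i hi).trans hcd)) ?_
            exact hP'.mono (Set.subset_insert _ _)
          have := (S.resamp_of_lt (c := d) (T := Set.Iio d) (fun _ h => h) _ hs).1 h
          simpa only [hupc] using this
        filter_upwards [h1, hcomm d hcd] with x h2 h3
        rw [h3] at h2
        simp only [Q, hupd]
        simpa only [Function.update_comm hcd.ne] using h2
      obtain ⟨s, hs, hQs⟩ := hQ'
      rcases s.eq_empty_or_nonempty with rfl | hne
      · have hQe : Supp (∅ : Set C) Q := ⟨∅, by simp, hQs⟩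
        obtain ⟨x, hx⟩ := hQ.exists
        obtain ⟨ζ, hζ⟩ := hx.exists
        exact Eventually.of_forall fun y => (hQe.empty _ y).mp hζ
      · exact ih (s.max' hne) (hs (s.max'_mem hne)) Q ⟨s, fun i hi => s.le_max' i hi, hQs⟩ hQ
    · exact S.eventually_of_fubini hdP h
    · refine h.mono fun x hx => ?_
      obtain ⟨ζ, hζ⟩ := hx.exists
      rwa [hP.update_of_notMem (fun h => not_le_of_gt hdc h)] at hζ
  refine S.resamp_of_imp fun P hP h => ?_
  obtain ⟨s, -, hPs⟩ := hP
  refine main ((insert c s).max' ⟨c, by simp⟩) P ⟨s, fun i hi => ?_, hPs⟩ h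
  exact Finset.le_max' _ _ (Finset.mem_insert_of_mem hi)

end WellFounded

/-- A strategy is pulled back by playing `σ c` at the coordinate `ρ c` and imposing nothing off the
range of ρ. -/
theorem tendsto_reindex {ρ : C → C} (hρ : StrictMono ρ)
    (hW : ∀ c x, S.W (ρ c) x = S.W c (x ∘ ρ)) :
    Tendsto (fun x : C → ZFSet.{u} => x ∘ ρ) S.filter S.filter := by
  intro A hA
  obtain ⟨σ, hσ, h⟩ := S.mem_filter.1 hA
  refine S.mem_filter.2 ⟨fun d x => {ζ | ∀ c, ρ c = d → ζ ∈ σ c (x ∘ ρ)}, ⟨?_, ?_⟩, ?_⟩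
  · intro d x
    by_cases hd : ∃ c, ρ c = d
    · obtain ⟨c, rfl⟩ := hd
      rw [S.meas_eq_of_W_eq (hW c x)]
      filter_upwards [hσ.mem c (x ∘ ρ)] with ζ hζ c' hc'
      rwa [hρ.injective hc']
    · filter_upwards with ζ c hc using absurd ⟨c, hc⟩ hd
  · intro d x y hxy
    ext ζ
    simp only [Set.mem_ofPred_eq]
    refine forall_congr' fun c => forall_congr' fun hc => ?_
    have : σ c (x ∘ ρ) = σ c (y ∘ ρ) := hσ.dep c fun i hi => hxy (ρ i) (hc ▸ hρ hi)
    rw [this]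
  · exact fun x hx => h _ fun c => hx (ρ c) c rfl

end System

/-! ### The collapsed ultrapower and Łoś's theorem -/

/-- The set with the given elements, if they form a small collection. -/
noncomputable def setOfSmall (A : Set ZFSet.{u}) : ZFSet.{u} :=
  open Classical in if _ : Small.{u} A then ZFSet.range (fun a : A => (a : ZFSet.{u})) else ∅

theorem mem_setOfSmall {A : Set ZFSet.{u}} [h : Small.{u} A] {z : ZFSet.{u}} :
    z ∈ setOfSmall A ↔ z ∈ A := by
  rw [setOfSmall, dif_pos h, ZFSet.mem_range]
  simp

theorem Supp.pi {C : Type w} {ι α : Type*} [Finite ι] {T : Set C}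
    {F : ι → (C → ZFSet.{u}) → α} (h : ∀ i, Supp T (F i)) : Supp T (fun x i => F i x) := by
  classical
  have := Fintype.ofFinite ι
  choose s hs hF using h
  refine ⟨Finset.univ.biUnion s, by simpa using hs, fun x y hxy => funext fun i => hF i fun c hc => ?_⟩
  exact hxy c (by simpa using ⟨i, hc⟩)

namespace System

variable {C : Type w} {T : Set C}

/-- The value of a function at a point, as an element of the universe. -/
def evalAt (T : Set C) (x : C → ZFSet.{u})
    (F : {F : (C → ZFSet.{u}) → ZFSet.{u} // Supp T F}) : ↥(Set.univ : Set ZFSet.{u}) :=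
  ⟨F.1 x, trivial⟩

theorem supp_realize {m n : ℕ} (φ : setLang.BoundedFormula (Fin m) n)
    (v : Fin m → {F : (C → ZFSet.{u}) → ZFSet.{u} // Supp T F})
    (xs : Fin n → {F : (C → ZFSet.{u}) → ZFSet.{u} // Supp T F}) :
    Supp T fun x => φ.Realize (evalAt T x ∘ v) (evalAt T x ∘ xs) :=
  (Supp.pi fun i => (v i).2).comp₂ (Supp.pi fun i => (xs i).2) fun a b =>
    φ.Realize (M := ↥(Set.univ : Set ZFSet.{u})) (fun i => ⟨a i, trivial⟩) fun i => ⟨b i, trivial⟩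

end System

namespace System

variable {C : Type w} [LinearOrder C] (S : System.{u} C)

theorem eventually_mem_cardSet (c : C) : ∀ᶠ x in S.filter, x c ∈ S.cardSet c x := by
  refine S.eventually_coord c (P := fun x ζ => ζ ∈ S.cardSet c x) (fun x y hxy => ?_)
    fun x => (S.isNormalUF c x).mem
  have : S.cardSet c x = S.cardSet c y := by
    obtain ⟨s, hs, h⟩ := S.supp_cardSet (S.coe_dep_subset c)
    exact h fun i hi => hxy i (hs hi)
  simp only [this]

theorem eventually_mem_bound (c : C) :
    ∀ᶠ x in S.filter, x c ∈ S.bound.ord.toZFSet := by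
  filter_upwards [S.eventually_mem_cardSet c] with x hx
  exact Ordinal.toZFSet_subset_toZFSet_iff.2 (Cardinal.ord_le_ord.2 (S.card_le c x)) hx

/-- A counterexample is chosen from the predicate `P x` alone, so it inherits the support of P. -/
theorem eventually_forall {T : Set C} {P : (C → ZFSet.{u}) → ZFSet.{u} → Prop} (hP : Supp T P)
    (h : ∀ K, Supp T K → ∀ᶠ x in S.filter, P x (K x)) : ∀ᶠ x in S.filter, ∀ z, P x z := by
  filter_upwards [h _ (hP.comp fun p => Classical.epsilon fun z => ¬ p z)] with x hx z
  by_contra hz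
  exact Classical.epsilon_spec (p := fun z => ¬ P x z) ⟨z, hz⟩ hx

theorem exists_of_eventually {T : Set C} {P : (C → ZFSet.{u}) → ZFSet.{u} → Prop} (hP : Supp T P)
    (h : ∀ᶠ x in S.filter, ∃ z, P x z) : ∃ K, Supp T K ∧ ∀ᶠ x in S.filter, P x (K x) :=
  ⟨_, hP.comp fun p => Classical.epsilon p, h.mono fun _ hx => Classical.epsilon_spec hx⟩

theorem term_eq_var {α : Type*} (t : setLang.Term α) : ∃ a, t = Language.Term.var a := by
  cases t with
  | var a => exact ⟨a, rfl⟩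
  | func f _ => exact Empty.elim f

variable [WellFoundedLT C]

theorem wellFounded_mem :
    WellFounded fun F H : (C → ZFSet.{u}) → ZFSet.{u} => ∀ᶠ x in S.filter, F x ∈ H x :=
  wellFounded_eventually_mem S.filter

/-- The element represented by a function in the collapse of the ultrapower formed with the
functions with finite support in `T`. -/
noncomputable def val (T : Set C) : ((C → ZFSet.{u}) → ZFSet.{u}) → ZFSet.{u} :=
  S.wellFounded_mem.fix fun H r =>
    setOfSmall {z | ∃ K, ∃ h : ∀ᶠ x in S.filter, K x ∈ H x, Supp T K ∧ r K h = z}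

theorem val_eq (T : Set C) (H : (C → ZFSet.{u}) → ZFSet.{u}) : S.val T H =
    setOfSmall {z | ∃ K, (∀ᶠ x in S.filter, K x ∈ H x) ∧ Supp T K ∧ S.val T K = z} := by
  rw [val, S.wellFounded_mem.fix_eq]
  simp only [exists_prop]

theorem val_congr {T : Set C} {F H : (C → ZFSet.{u}) → ZFSet.{u}}
    (h : ∀ᶠ x in S.filter, F x = H x) : S.val T F = S.val T H := by
  rw [val_eq, val_eq]
  congr 1
  ext z
  simp only [Set.mem_ofPred_eq]
  refine exists_congr fun K => and_congr_left' (eventually_congr (h.mono fun x hx => ?_))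
  rw [hx]

/-- Modulo the filter, a K ∈ H with support in a finite s is a function from `B`^s to a set of
possible values, and a small T has only a small collection of finite subsets. -/
theorem small_val (T : Set C) [Small.{u} T] {H : (C → ZFSet.{u}) → ZFSet.{u}} (hH : Supp T H) :
    Small.{u} {z | ∃ K, (∀ᶠ x in S.filter, K x ∈ H x) ∧ Supp T K ∧ S.val T K = z} := by
  classical
  obtain ⟨s₀, hs₀, hH⟩ := hH
  let B : ZFSet.{u} := S.bound.ord.toZFSet
  let A : Finset C → Set ZFSet.{u} := fun s =>
    {z | ∃ K, (∀ᶠ x in S.filter, K x ∈ H x) ∧ DependsOn K (s : Set C) ∧ S.val T K = z}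
  have hA : ∀ s : Finset C, s₀ ⊆ s → Small.{u} (A s) := by
    intro s hs
    have i1 : Small.{u} {c // c ∈ s} := Countable.toSmall _
    have i2 : Small.{u} ({c // c ∈ s} → B) := small_Pi.{u} _
    let e : ({c // c ∈ s} → B) → C → ZFSet.{u} := fun y c => if h : c ∈ s then y ⟨c, h⟩ else ∅
    let V₀ : ZFSet.{u} := insert ∅ (ZFSet.iUnion fun y => H (e y))
    have i3 : Small.{u} (({c // c ∈ s} → B) → V₀) := small_Pi.{u} _
    -- The canonical function with table `g`; ∅ is its value off the large set where the coordinates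
    -- in `s` lie in `B`.
    let can : (({c // c ∈ s} → B) → V₀) → (C → ZFSet.{u}) → ZFSet.{u} := fun g x =>
      if h : ∀ c : {c // c ∈ s}, x c ∈ B then g fun c => ⟨x c, h c⟩ else ∅
    refine small_subset (s := Set.range fun g => S.val T (can g)) ?_
    rintro z ⟨K, hK, hKs, rfl⟩
    refine ⟨fun y => if h : K (e y) ∈ V₀ then ⟨K (e y), h⟩ else ⟨∅, ZFSet.mem_insert _ _⟩, ?_⟩
    refine S.val_congr ?_
    have hB : ∀ᶠ x in S.filter, ∀ c ∈ s, x c ∈ B :=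
      (Filter.eventually_all_finset s).2 fun c _ => S.eventually_mem_bound c
    filter_upwards [hK, hB] with x h1 h2
    have h3 : ∀ c : {c // c ∈ s}, x c ∈ B := fun c => h2 c c.2
    have hex : ∀ c ∈ s, e (fun c => ⟨x c, h3 c⟩) c = x c := fun c hc => by simp [e, hc]
    have h4 : K (e fun c => ⟨x c, h3 c⟩) = K x := hKs hex
    have h5 : H (e fun c => ⟨x c, h3 c⟩) = H x := hH fun c hc => hex c (hs hc)
    have h6 : K x ∈ V₀ := ZFSet.mem_insert_of_mem _
      (ZFSet.mem_iUnion.2 ⟨fun c => ⟨x c, h3 c⟩, by rw [h5]; exact h1⟩)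
    simp only [can, dif_pos h3, h4, dif_pos h6]
  let f : Finset (Shrink.{u} T) → Finset C := fun t =>
    s₀ ∪ t.image fun i => (((equivShrink T).symm i : T) : C)
  have : ∀ t, Small.{u} (A (f t)) := fun t => hA _ Finset.subset_union_left
  refine small_subset (s := ⋃ t, A (f t)) ?_
  rintro z ⟨K, hK, ⟨s, hs, hKs⟩, rfl⟩
  refine Set.mem_iUnion.2 ⟨s.attach.image fun c : {c // c ∈ s} => equivShrink T ⟨c.1, hs c.2⟩,
    K, hK, ?_, rfl⟩
  refine hKs.mono fun c hc => ?_
  simp only [f, Finset.coe_union, Set.mem_union, Finset.mem_coe, Finset.mem_image]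
  exact Or.inr ⟨_, ⟨⟨c, hc⟩, by simp, rfl⟩, by simp⟩

/-- The collapse of the ultrapower formed with the functions with finite support in `T`. -/
def model (T : Set C) : Set ZFSet.{u} := S.val T '' {F | Supp T F}

variable {S} {T : Set C} {F H : (C → ZFSet.{u}) → ZFSet.{u}}

theorem val_mem_model (hF : Supp T F) : S.val T F ∈ S.model T := ⟨F, hF, rfl⟩

/-- The element of the model represented by a function with finite support. -/
noncomputable def toModel (S : System.{u} C) (T : Set C)
    (F : {F : (C → ZFSet.{u}) → ZFSet.{u} // Supp T F}) : S.model T :=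
  ⟨S.val T F.1, val_mem_model F.2⟩

theorem toModel_surjective : Function.Surjective (S.toModel T) := by
  rintro ⟨_, F, hF, rfl⟩
  exact ⟨⟨F, hF⟩, rfl⟩

variable [Small.{u} T]

theorem mem_val_iff (hH : Supp T H) {z : ZFSet.{u}} :
    z ∈ S.val T H ↔ ∃ K, Supp T K ∧ (∀ᶠ x in S.filter, K x ∈ H x) ∧ S.val T K = z := by
  have := S.small_val T hH
  rw [val_eq, mem_setOfSmall, Set.mem_ofPred_eq]
  exact exists_congr fun K => by tauto

/-- Extensionality modulo the filter. If F and H differ, choose K with support in T in their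
symmetric difference. Its collapse lies in both sides, so the induction hypothesis equates K with an
element of the other function. -/
theorem val_eq_val_iff (hF : Supp T F) (hH : Supp T H) :
    S.val T F = S.val T H ↔ ∀ᶠ x in S.filter, F x = H x := by
  refine ⟨fun h => ?_, S.val_congr⟩
  induction F using S.wellFounded_mem.induction generalizing H with
  | _ F ih =>
  by_contra hne
  rw [← S.eventually_not (hF.comp₂ hH Eq)] at hne
  obtain ⟨K, hK, hKx⟩ := S.exists_of_eventually (T := T)
    (P := fun x z => ¬ (z ∈ F x ↔ z ∈ H x)) (hF.comp₂ hH fun a b z => ¬ (z ∈ a ↔ z ∈ b))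
    (hne.mono fun x hx => by
      by_contra! hcon
      exact hx (ZFSet.ext hcon))
  rcases S.em_of_supp (hK.comp₂ hF fun a b => a ∈ b) with h1 | h1
  · obtain ⟨K', hK', h2, h3⟩ := (mem_val_iff hH).1 (h ▸ (mem_val_iff hF).2 ⟨K, hK, h1, rfl⟩)
    have h4 := ih K h1 hK hK' h3.symm
    obtain ⟨x, h5, h6, h7, h8⟩ := (h1.and (h2.and (h4.and hKx))).exists
    exact h8 ⟨fun _ => h7 ▸ h6, fun _ => h5⟩
  · have h1' : ∀ᶠ x in S.filter, K x ∈ H x := by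
      filter_upwards [h1, hKx] with x h2 h3
      by_contra h4
      exact h3 ⟨fun h => absurd h h2, fun h => absurd h h4⟩
    obtain ⟨K', hK', h2, h3⟩ := (mem_val_iff hF).1 (h ▸ (mem_val_iff hH).2 ⟨K, hK, h1', rfl⟩)
    have h4 := ih K' h2 hK' hK h3
    obtain ⟨x, h5, h6, h7⟩ := (h1.and (h2.and h4)).exists
    exact h5 (h7 ▸ h6)

theorem val_mem_val_iff (hF : Supp T F) (hH : Supp T H) :
    S.val T F ∈ S.val T H ↔ ∀ᶠ x in S.filter, F x ∈ H x := by
  rw [mem_val_iff hH]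
  refine ⟨fun ⟨K, hK, h1, h2⟩ => ?_, fun h => ⟨F, hF, h, rfl⟩⟩
  filter_upwards [h1, (val_eq_val_iff hK hF).1 h2] with x h3 h4 using h4 ▸ h3

theorem isTransClass_model : IsTransClass (S.model T) := by
  rintro _ ⟨H, hH, rfl⟩ y hy
  obtain ⟨K, hK, -, rfl⟩ := (mem_val_iff hH).1 hy
  exact val_mem_model hK

/-- Łoś's theorem. -/
theorem realize_iff {m n : ℕ} (φ : setLang.BoundedFormula (Fin m) n)
    (v : Fin m → {F : (C → ZFSet.{u}) → ZFSet.{u} // Supp T F})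
    (xs : Fin n → {F : (C → ZFSet.{u}) → ZFSet.{u} // Supp T F}) :
    φ.Realize (S.toModel T ∘ v) (S.toModel T ∘ xs) ↔
      ∀ᶠ x in S.filter, φ.Realize (evalAt T x ∘ v) (evalAt T x ∘ xs) := by
  have hterm : ∀ {n : ℕ} (t : setLang.Term (Fin m ⊕ Fin n))
      (xs : Fin n → {F : (C → ZFSet.{u}) → ZFSet.{u} // Supp T F}),
      ∃ F : {F : (C → ZFSet.{u}) → ZFSet.{u} // Supp T F},
        t.realize (Sum.elim (S.toModel T ∘ v) (S.toModel T ∘ xs)) = S.toModel T F ∧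
        ∀ x, t.realize (Sum.elim (evalAt T x ∘ v) (evalAt T x ∘ xs)) = evalAt T x F := by
    intro n t xs
    obtain ⟨a, rfl⟩ := term_eq_var t
    rcases a with a | a
    · exact ⟨v a, rfl, fun _ => rfl⟩
    · exact ⟨xs a, rfl, fun _ => rfl⟩
  induction φ with
  | falsum => simp [Language.BoundedFormula.Realize, (inferInstance : S.filter.NeBot).ne]
  | equal t₁ t₂ =>
    obtain ⟨F₁, h₁, h₁'⟩ := hterm t₁ xs
    obtain ⟨F₂, h₂, h₂'⟩ := hterm t₂ xs
    simp only [Language.BoundedFormula.Realize, h₁, h₂, h₁', h₂']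
    refine Subtype.ext_iff.trans ((val_eq_val_iff F₁.2 F₂.2).trans ?_)
    exact eventually_congr (Eventually.of_forall fun x => ⟨fun h => Subtype.ext h, fun h => congrArg Subtype.val h⟩)
  | rel R ts =>
    cases R with
    | mem =>
      obtain ⟨F₁, h₁, h₁'⟩ := hterm (ts 0) xs
      obtain ⟨F₂, h₂, h₂'⟩ := hterm (ts 1) xs
      change (((ts 0).realize _ : S.model T) : ZFSet.{u}) ∈
        (((ts 1).realize _ : S.model T) : ZFSet.{u}) ↔ ∀ᶠ x in S.filter,
          (((ts 0).realize _ : ↥(Set.univ : Set ZFSet.{u})) : ZFSet.{u}) ∈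
            (((ts 1).realize _ : ↥(Set.univ : Set ZFSet.{u})) : ZFSet.{u})
      simp only [h₁, h₂, h₁', h₂']
      exact val_mem_val_iff F₁.2 F₂.2
  | imp φ ψ ih₁ ih₂ =>
    simp only [Language.BoundedFormula.realize_imp, ih₁, ih₂]
    refine ⟨fun h => ?_, fun h h' => by filter_upwards [h, h'] with x h1 h2 using h1 h2⟩
    rcases S.em_of_supp (supp_realize φ v xs) with h1 | h1
    · exact (h h1).mono fun x hx _ => hx
    · exact h1.mono fun x hx hx' => absurd hx' hx
  | all φ ih =>
    simp only [Language.BoundedFormula.realize_all]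
    have h1 : (∀ a : S.model T, φ.Realize (S.toModel T ∘ v) (Fin.snoc (S.toModel T ∘ xs) a)) ↔
        ∀ K : {F : (C → ZFSet.{u}) → ZFSet.{u} // Supp T F}, ∀ᶠ x in S.filter,
          φ.Realize (evalAt T x ∘ v) (Fin.snoc (evalAt T x ∘ xs) (evalAt T x K)) := by
      rw [toModel_surjective.forall]
      refine forall_congr' fun K => ?_
      have := ih (Fin.snoc xs K)
      simpa only [Fin.comp_snoc] using this
    rw [h1]
    refine ⟨fun h => ?_, fun h K => h.mono fun x hx => hx _⟩
    -- The hypothesis gives one large set for each function K; a counterexample depending on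
    -- finitely many coordinates yields a large set good for all values at once.
    have := S.eventually_forall (T := T) (P := fun x z =>
        φ.Realize (evalAt T x ∘ v) (Fin.snoc (evalAt T x ∘ xs) ⟨z, trivial⟩))
      ((Supp.pi fun i => (v i).2).comp₂ (Supp.pi fun i => (xs i).2) fun a b z =>
        φ.Realize (M := ↥(Set.univ : Set ZFSet.{u})) (fun i => ⟨a i, trivial⟩)
          (Fin.snoc (α := fun _ => ↥(Set.univ : Set ZFSet.{u})) (fun i => ⟨b i, trivial⟩)
            ⟨z, trivial⟩))
      (fun K hK => h ⟨K, hK⟩)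
    exact this.mono fun x hx a => hx a.1

/-- The elementary embedding between two models induced by a measure preserving map. -/
noncomputable def embedding {T' : Set C} [Small.{u} T'] (r : (C → ZFSet.{u}) → C → ZFSet.{u})
    (hr : Tendsto r S.filter S.filter)
    (hs : ∀ F : (C → ZFSet.{u}) → ZFSet.{u}, Supp T F → Supp T' (F ∘ r)) :
    S.model T ↪ₑ[setLang] S.model T' where
  toFun y := S.toModel T' ⟨_, hs _ (Classical.choose (toModel_surjective y)).2⟩
  map_formula' n φ y := by
    set v : Fin n → {F : (C → ZFSet.{u}) → ZFSet.{u} // Supp T F} := fun i =>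
      Classical.choose (toModel_surjective (S := S) (y i)) with hv
    have hy : y = S.toModel T ∘ v := funext fun i =>
      (Classical.choose_spec (toModel_surjective (S := S) (y i))).symm
    have h1 := realize_iff (S := S) (T := T') φ (fun i => ⟨_, hs _ (v i).2⟩) (default : Fin 0 → _)
    have h2 := realize_iff (S := S) (T := T) φ v (default : Fin 0 → _)
    have e : ∀ {M : Type (u + 1)} (a b : Fin 0 → M), a = b := fun a b => Subsingleton.elim a b
    have h3 : ∀ x, φ.Realize (evalAt T' x ∘ fun i =>
        (⟨_, hs _ (v i).2⟩ : {F : (C → ZFSet.{u}) → ZFSet.{u} // Supp T' F})) ↔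
        φ.Realize (evalAt T (r x) ∘ v) := fun x => Iff.rfl
    have h4 : (φ.Realize ((fun y : S.model T => S.toModel T'
        ⟨_, hs _ (Classical.choose (toModel_surjective y)).2⟩) ∘ y)) ↔
        ∀ᶠ x in S.filter, φ.Realize (evalAt T (r x) ∘ v) := by
      refine Iff.trans (iff_of_eq ?_) (h1.trans (iff_of_eq ?_))
      · exact congrArg _ (e _ _)
      · congr 1
        funext x
        exact congrArg _ (e _ _)
    have h5 : φ.Realize (S.toModel T ∘ v) ↔ ∀ᶠ x in S.filter, φ.Realize (evalAt T x ∘ v) := by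
      refine Iff.trans (iff_of_eq ?_) (h2.trans (iff_of_eq ?_))
      · exact congrArg _ (e _ _)
      · congr 1
        funext x
        exact congrArg _ (e _ _)
    rw [h4]
    conv_rhs => rw [hy, h5]
    refine ⟨fun h => ?_, fun h => hr.eventually h⟩
    have hsup : Supp T fun x => φ.Realize (evalAt T x ∘ v) :=
      (Supp.pi fun i => (v i).2).comp fun a =>
        φ.Realize (M := ↥(Set.univ : Set ZFSet.{u})) (fun i => ⟨a i, trivial⟩)
    refine (S.em_of_supp hsup).resolve_right fun h' => ?_
    obtain ⟨x, h6, h7⟩ := (h.and (hr.eventually h')).exists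
    exact h7 h6

theorem embedding_val {T' : Set C} [Small.{u} T'] {r : (C → ZFSet.{u}) → C → ZFSet.{u}}
    (hr : Tendsto r S.filter S.filter)
    (hs : ∀ F : (C → ZFSet.{u}) → ZFSet.{u}, Supp T F → Supp T' (F ∘ r)) (hF : Supp T F) :
    (embedding r hr hs ⟨S.val T F, val_mem_model hF⟩ : ZFSet.{u}) = S.val T' (F ∘ r) := by
  have h := Classical.choose_spec
    (toModel_surjective (S := S) (T := T) ⟨S.val T F, val_mem_model hF⟩)
  set K := Classical.choose (toModel_surjective (S := S) (T := T) ⟨S.val T F, val_mem_model hF⟩)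
  change S.val T' (K.1 ∘ r) = S.val T' (F ∘ r)
  exact S.val_congr (hr.eventually ((val_eq_val_iff K.2 hF).1 (congrArg Subtype.val h)))

/-- Functions with empty support are constant, so the collapse is the identity on V. -/
theorem val_empty_const (a : ZFSet.{u}) : S.val ∅ (fun _ => a) = a := by
  induction a using ZFSet.inductionOn with
  | _ a ih =>
  ext z
  rw [mem_val_iff (Supp.const a)]
  constructor
  · rintro ⟨K, hK, h1, rfl⟩
    obtain ⟨x, hx⟩ := h1.exists
    have : K = fun _ => K x := funext fun y => hK.empty y x
    rw [this, ih _ hx]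
    exact hx
  · exact fun hz => ⟨fun _ => z, Supp.const z, Eventually.of_forall fun _ => hz, ih z hz⟩

theorem model_empty : S.model ∅ = Set.univ :=
  Set.eq_univ_of_forall fun a => ⟨fun _ => a, Supp.const a, val_empty_const a⟩

theorem isOrdinal_val (hF : Supp T F) (h : ∀ᶠ x in S.filter, (F x).IsOrdinal) :
    (S.val T F).IsOrdinal := by
  refine ⟨fun z hz w hw => ?_, fun {z y w} hzy hyw hw => ?_⟩
  · obtain ⟨K, hK, h1, rfl⟩ := (mem_val_iff hF).1 hz
    obtain ⟨L, hL, h2, rfl⟩ := (mem_val_iff hK).1 hw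
    rw [val_mem_val_iff hL hF]
    filter_upwards [h, h1, h2] with x h3 h4 h5 using h3.mem_trans h5 h4
  · obtain ⟨K, hK, h1, rfl⟩ := (mem_val_iff hF).1 hw
    obtain ⟨L, hL, h2, rfl⟩ := (mem_val_iff hK).1 hyw
    obtain ⟨N, hN, h3, rfl⟩ := (mem_val_iff hL).1 hzy
    rw [val_mem_val_iff hN hK]
    filter_upwards [h, h1, h2, h3] with x h4 h5 h6 h7 using (h4.mem h5).mem_trans h7 h6

theorem rank_le_rank_val (a : ZFSet.{u}) : a.rank ≤ (S.val T fun _ => a).rank := by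
  induction a using ZFSet.inductionOn with
  | _ a ih =>
  rw [ZFSet.rank_le_iff]
  intro y hy
  refine (ih y hy).trans_lt (ZFSet.rank_lt_of_mem ?_)
  exact (val_mem_val_iff (Supp.const y) (Supp.const a)).2 (Eventually.of_forall fun _ => hy)

/-- The image of an ordinal is an ordinal of at least its rank, and the model is transitive. -/
theorem ordinal_mem_model {a : ZFSet.{u}} (ha : a.IsOrdinal) : a ∈ S.model T := by
  have h1 : (S.val T fun _ => a).IsOrdinal :=
    isOrdinal_val (Supp.const a) (Eventually.of_forall fun _ => ha)
  have h2 := (ha.rank_le_iff_subset h1).1 (rank_le_rank_val a)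
  rcases (ha.subset_iff_eq_or_mem h1).1 h2 with h3 | h3
  · rw [h3]
    exact val_mem_model (Supp.const a)
  · exact isTransClass_model _ (val_mem_model (Supp.const a)) _ h3

end System

/-! ### Adding one coordinate is an ultrapower -/

theorem IsTransClass.of_pair_mem {M : Set ZFSet.{u}} (hM : IsTransClass M) {a b : ZFSet.{u}}
    (h : ZFSet.pair a b ∈ M) : b ∈ M :=
  hM {a, b} (hM _ h {a, b} (by simp [ZFSet.pair])) b (by simp)

/-- The value of the function `f` at `ξ`. -/
noncomputable def app (f ξ : ZFSet.{u}) : ZFSet.{u} :=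
  Classical.epsilon fun y => ZFSet.pair ξ y ∈ f

theorem app_eq {f ξ y : ZFSet.{u}} (h : ZFSet.pair ξ y ∈ f)
    (hu : ∀ z, ZFSet.pair ξ z ∈ f → z = y) : app f ξ = y :=
  hu _ (Classical.epsilon_spec (p := fun y => ZFSet.pair ξ y ∈ f) ⟨y, h⟩)

/-- The restriction of the function `h` to the set `I`. -/
noncomputable def graphOn (I : ZFSet.{u}) (h : ZFSet.{u} → ZFSet.{u}) : ZFSet.{u} :=
  ZFSet.range fun ξ : I => ZFSet.pair ξ (h ξ)

theorem mem_graphOn {I : ZFSet.{u}} {h : ZFSet.{u} → ZFSet.{u}} {z : ZFSet.{u}} :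
    z ∈ graphOn I h ↔ ∃ ξ ∈ I, ZFSet.pair ξ (h ξ) = z := by
  simp [graphOn, ZFSet.mem_range]

theorem pair_mem_graphOn {I : ZFSet.{u}} {h : ZFSet.{u} → ZFSet.{u}} {a b : ZFSet.{u}} :
    ZFSet.pair a b ∈ graphOn I h ↔ a ∈ I ∧ b = h a := by
  rw [mem_graphOn]
  constructor
  · rintro ⟨ξ, hξ, h'⟩
    obtain ⟨rfl, rfl⟩ := ZFSet.pair_inj.1 h'
    exact ⟨hξ, rfl⟩
  · rintro ⟨ha, rfl⟩
    exact ⟨a, ha, rfl⟩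

theorem app_graphOn {I : ZFSet.{u}} {h : ZFSet.{u} → ZFSet.{u}} {a : ZFSet.{u}} (ha : a ∈ I) :
    app (graphOn I h) a = h a :=
  app_eq (pair_mem_graphOn.2 ⟨ha, rfl⟩) fun _ hz => (pair_mem_graphOn.1 hz).2

namespace System

section

variable {C : Type w} {T T' : Set C} {c : C} {F : (C → ZFSet.{u}) → ZFSet.{u}}

theorem supp_app (hT' : T' = insert c T) (hF : Supp T F) : Supp T' fun x => app (F x) (x c) := by
  subst hT'
  exact (hF.mono (Set.subset_insert _ _)).comp₂ (Supp.coord (Set.mem_insert _ _)) app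

variable [LinearOrder C] {S : System.{u} C}

/-- How a representative loses its dependence on c: if almost all resamplings give one value, that
value is a function of the coordinates in T. -/
theorem exists_eq_of_constant (hT' : T' = insert c T) (hc : c ∉ T)
    (hdep : (S.dep c : Set C) ⊆ T) (hres : S.Resamp c T) {K : (C → ZFSet.{u}) → ZFSet.{u}}
    (hK : Supp T' K)
    (h : ∀ᶠ x in S.filter, ∃ a, ∀ᶠ ζ in S.meas c x, K (Function.update x c ζ) = a) :
    ∃ g, Supp T g ∧ ∀ᶠ x in S.filter, K x = g x := by
  subst hT'
  obtain ⟨g, hg, h1⟩ := S.exists_of_eventually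
    (P := fun x a => ∀ᶠ ζ in S.meas c x, K (Function.update x c ζ) = a)
    ((S.supp_meas hdep).comp₂ hK.curry fun l k a => ∀ᶠ ζ in (l : Filter ZFSet.{u}), k ζ = a) h
  refine ⟨g, hg, ?_⟩
  rw [hres _ (hK.comp₂ (hg.mono (Set.subset_insert _ _)) Eq)]
  simpa only [hg.update_of_notMem hc] using h1

theorem eventually_meas_of_eventually (hT' : T' = insert c T) (hc : c ∉ T) (hres : S.Resamp c T)
    {K : (C → ZFSet.{u}) → ZFSet.{u}} (hK : Supp T' K) (hF : Supp T F)
    (R : ZFSet.{u} → ZFSet.{u} → ZFSet.{u} → Prop) :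
    (∀ᶠ x in S.filter, R (K x) (F x) (x c)) ↔
      ∀ᶠ x in S.filter, ∀ᶠ ζ in S.meas c x, R (K (Function.update x c ζ)) (F x) ζ := by
  subst hT'
  rw [hres _ ((hK.comp₂ (hF.mono (Set.subset_insert _ _)) Prod.mk).comp₂
    (Supp.coord (Set.mem_insert _ _)) fun a b => R a.1 a.2 b)]
  simp only [hF.update_of_notMem hc, Function.update_self]

end

variable {C : Type w} [LinearOrder C] [WellFoundedLT C] {S : System.{u} C} {T : Set C}
  {F H : (C → ZFSet.{u}) → ZFSet.{u}} [Small.{u} T]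

theorem val_upair (hF : Supp T F) (hH : Supp T H) :
    S.val T (fun x => {F x, H x}) = {S.val T F, S.val T H} := by
  have hP : Supp T fun x => ({F x, H x} : ZFSet.{u}) := hF.comp₂ hH fun a b => ({a, b} : ZFSet.{u})
  ext z
  rw [mem_val_iff hP, ZFSet.mem_pair]
  constructor
  · rintro ⟨K, hK, h1, rfl⟩
    rw [val_eq_val_iff hK hF, val_eq_val_iff hK hH]
    rcases S.em_of_supp (hK.comp₂ hF Eq) with h2 | h2
    · exact Or.inl h2
    · right
      filter_upwards [h1, h2] with x h3 h4
      exact (ZFSet.mem_pair.1 h3).resolve_left h4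
  · rintro (rfl | rfl)
    · exact ⟨F, hF, Eventually.of_forall fun x => by simp, rfl⟩
    · exact ⟨H, hH, Eventually.of_forall fun x => by simp, rfl⟩

theorem val_pair (hF : Supp T F) (hH : Supp T H) :
    S.val T (fun x => ZFSet.pair (F x) (H x)) = ZFSet.pair (S.val T F) (S.val T H) := by
  have h1 : Supp T fun x => ({F x} : ZFSet.{u}) := hF.comp fun a => ({a} : ZFSet.{u})
  have h2 : Supp T fun x => ({F x, H x} : ZFSet.{u}) := hF.comp₂ hH fun a b => ({a, b} : ZFSet.{u})
  have h3 : S.val T (fun x => ({F x} : ZFSet.{u})) = {S.val T F} := by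
    simpa only [ZFSet.pair_eq_singleton] using val_upair hF hF (S := S)
  rw [ZFSet.pair, ← h3, ← val_upair hF hH, ← val_upair h1 h2]
  rfl

theorem val_sUnion (hF : Supp T F) :
    S.val T (fun x => ZFSet.sUnion (F x)) = ZFSet.sUnion (S.val T F) := by
  have hU : Supp T fun x => ZFSet.sUnion (F x) := hF.comp fun a => ZFSet.sUnion a
  ext z
  rw [mem_val_iff hU, ZFSet.mem_sUnion]
  constructor
  · rintro ⟨K, hK, h1, rfl⟩
    obtain ⟨A, hA, h2⟩ := S.exists_of_eventually (P := fun x z => z ∈ F x ∧ K x ∈ z)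
      (hF.comp₂ hK fun a b z => z ∈ a ∧ b ∈ z)
      (h1.mono fun x hx => by simpa using ZFSet.mem_sUnion.1 hx)
    exact ⟨_, (val_mem_val_iff hA hF).2 (h2.mono fun x hx => hx.1),
      (val_mem_val_iff hK hA).2 (h2.mono fun x hx => hx.2)⟩
  · rintro ⟨y, hy, hz⟩
    obtain ⟨A, hA, h1, rfl⟩ := (mem_val_iff hF).1 hy
    obtain ⟨K, hK, h2, rfl⟩ := (mem_val_iff hA).1 hz
    refine ⟨K, hK, ?_, rfl⟩
    filter_upwards [h1, h2] with x h3 h4 using ZFSet.mem_sUnion.2 ⟨_, h3, h4⟩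

theorem pair_mem_val_iff {K : (C → ZFSet.{u}) → ZFSet.{u}} (hF : Supp T F) (hK : Supp T K)
    {b : ZFSet.{u}} : ZFSet.pair (S.val T K) b ∈ S.val T F ↔
      ∃ B, Supp T B ∧ S.val T B = b ∧ ∀ᶠ x in S.filter, ZFSet.pair (K x) (B x) ∈ F x := by
  constructor
  · intro h
    obtain ⟨B, hB, rfl⟩ := (isTransClass_model (S := S) (T := T)).of_pair_mem
      (isTransClass_model _ (val_mem_model hF) _ h)
    rw [← val_pair hK hB, val_mem_val_iff (hK.comp₂ hB ZFSet.pair) hF] at h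
    exact ⟨B, hB, rfl, h⟩
  · rintro ⟨B, hB, rfl, h⟩
    rwa [← val_pair hK hB, val_mem_val_iff (hK.comp₂ hB ZFSet.pair) hF]

/-- To be applied with R equal to `=` or `∈`, for which `hR` is the atomic case of Łoś's theorem. -/
theorem val_valSet {R : ZFSet.{u} → ZFSet.{u} → Prop} {I : (C → ZFSet.{u}) → ZFSet.{u}}
    (hR : ∀ F H, Supp T F → Supp T H →
      (R (S.val T F) (S.val T H) ↔ ∀ᶠ x in S.filter, R (F x) (H x)))
    (hI : Supp T I) (hF : Supp T F) (hH : Supp T H) :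
    S.val T (fun x => valSet R (I x) (F x) (H x)) =
      valSet R (S.val T I) (S.val T F) (S.val T H) := by
  have hV : Supp T fun x => valSet R (I x) (F x) (H x) :=
    (hI.comp₂ hF Prod.mk).comp₂ hH fun a b => valSet R a.1 a.2 b
  ext z
  rw [mem_val_iff hV, valSet, ZFSet.mem_sep]
  constructor
  · rintro ⟨K, hK, h1, rfl⟩
    simp only [valSet, ZFSet.mem_sep] at h1
    refine ⟨(val_mem_val_iff hK hI).2 (h1.mono fun x hx => hx.1), ?_⟩
    obtain ⟨A, hA, h2⟩ := S.exists_of_eventually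
      (P := fun x a => ∃ b, ZFSet.pair (K x) a ∈ F x ∧ ZFSet.pair (K x) b ∈ H x ∧ R a b)
      ((hK.comp₂ hF Prod.mk).comp₂ hH fun k h a => ∃ b, ZFSet.pair k.1 a ∈ k.2 ∧
        ZFSet.pair k.1 b ∈ h ∧ R a b)
      (h1.mono fun x hx => hx.2)
    obtain ⟨B, hB, h3⟩ := S.exists_of_eventually
      (P := fun x b => ZFSet.pair (K x) (A x) ∈ F x ∧ ZFSet.pair (K x) b ∈ H x ∧ R (A x) b)
      ((hK.comp₂ hF Prod.mk).comp₂ (hH.comp₂ hA Prod.mk) fun k h b => ZFSet.pair k.1 h.2 ∈ k.2 ∧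
        ZFSet.pair k.1 b ∈ h.1 ∧ R h.2 b) h2
    exact ⟨_, _, (pair_mem_val_iff hF hK).2 ⟨A, hA, rfl, h3.mono fun x hx => hx.1⟩,
      (pair_mem_val_iff hH hK).2 ⟨B, hB, rfl, h3.mono fun x hx => hx.2.1⟩,
      (hR A B hA hB).2 (h3.mono fun x hx => hx.2.2)⟩
  · rintro ⟨hz, a, b, ha, hb, hab⟩
    obtain ⟨K, hK, h1, rfl⟩ := (mem_val_iff hI).1 hz
    obtain ⟨A, hA, rfl, h2⟩ := (pair_mem_val_iff hF hK).1 ha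
    obtain ⟨B, hB, rfl, h3⟩ := (pair_mem_val_iff hH hK).1 hb
    refine ⟨K, hK, ?_, rfl⟩
    filter_upwards [h1, h2, h3, (hR A B hA hB).1 hab] with x h4 h5 h6 h7
    exact ZFSet.mem_sep.2 ⟨h4, _, _, h5, h6, h7⟩

theorem eventually_isFunc {I : (C → ZFSet.{u}) → ZFSet.{u}} (hI : Supp T I) (hF : Supp T F)
    (h : S.val T F ∈ funcsOn (S.model T) (S.val T I)) :
    ∀ᶠ x in S.filter, ∀ ξ, ξ ∈ I x → ∃! a, ZFSet.pair ξ a ∈ F x := by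
  refine S.eventually_forall (hI.comp₂ hF fun i f ξ => ξ ∈ i → ∃! a, ZFSet.pair ξ a ∈ f)
    fun K hK => ?_
  rcases S.em_of_supp (hK.comp₂ hI fun a b => a ∈ b) with h1 | h1
  swap
  · exact h1.mono fun x hx hx' => absurd hx' hx
  obtain ⟨-, y, -, hfun⟩ := h
  obtain ⟨a, ha, hu⟩ := hfun _ ((val_mem_val_iff hK hI).2 h1)
  obtain ⟨A, hA, rfl, h2⟩ := (pair_mem_val_iff hF hK).1 ha
  have h3 : ∀ᶠ x in S.filter, ∀ b, ZFSet.pair (K x) b ∈ F x → b = A x := by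
    refine S.eventually_forall ((hK.comp₂ hF Prod.mk).comp₂ hA fun k a b =>
      ZFSet.pair k.1 b ∈ k.2 → b = a) fun B hB => ?_
    rcases S.em_of_supp ((hK.comp₂ hB ZFSet.pair).comp₂ hF fun a b => a ∈ b) with h4 | h4
    · have := hu _ ((pair_mem_val_iff hF hK).2 ⟨B, hB, rfl, h4⟩)
      exact ((val_eq_val_iff hB hA).1 this).mono fun x hx _ => hx
    · exact h4.mono fun x hx hx' => absurd hx' hx
  filter_upwards [h2, h3] with x h4 h5 _ using ⟨A x, h4, h5⟩

theorem val_graphOn {I : (C → ZFSet.{u}) → ZFSet.{u}} {h : (C → ZFSet.{u}) → ZFSet.{u} → ZFSet.{u}}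
    (hI : Supp T I) (hh : Supp T h) :
    S.val T (fun x => graphOn (I x) (h x)) ∈ funcsOn (S.model T) (S.val T I) := by
  have hG : Supp T fun x => graphOn (I x) (h x) := hI.comp₂ hh graphOn
  have hY : Supp T fun x => ZFSet.range fun ξ : I x => h x ξ :=
    hI.comp₂ hh fun i h => ZFSet.range fun ξ : i => h ξ
  refine ⟨val_mem_model hG, S.val T (fun x => ZFSet.range fun ξ : I x => h x ξ),
    fun z hz => ?_, fun z hz => ?_⟩
  · obtain ⟨K, hK, h1, rfl⟩ := (mem_val_iff hG).1 hz
    obtain ⟨Ξ, hΞ, h2⟩ := S.exists_of_eventually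
      (P := fun x ξ => ξ ∈ I x ∧ ZFSet.pair ξ (h x ξ) = K x)
      ((hI.comp₂ hh Prod.mk).comp₂ hK fun i k ξ => ξ ∈ i.1 ∧ ZFSet.pair ξ (i.2 ξ) = k)
      (h1.mono fun x hx => mem_graphOn.1 hx)
    have hB : Supp T fun x => h x (Ξ x) := hh.comp₂ hΞ fun a b => a b
    rw [← S.val_congr (h2.mono fun x hx => hx.2), val_pair hΞ hB, ZFSet.pair_mem_prod,
      val_mem_val_iff hΞ hI, val_mem_val_iff hB hY]
    exact ⟨h2.mono fun x hx => hx.1, h2.mono fun x hx => ZFSet.mem_range.2 ⟨⟨_, hx.1⟩, rfl⟩⟩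
  · obtain ⟨K, hK, h1, rfl⟩ := (mem_val_iff hI).1 hz
    have hB : Supp T fun x => h x (K x) := hh.comp₂ hK fun a b => a b
    refine ⟨_, (pair_mem_val_iff hG hK).2 ⟨_, hB, rfl, ?_⟩, fun b hb => ?_⟩
    · exact h1.mono fun x hx => pair_mem_graphOn.2 ⟨hx, rfl⟩
    · obtain ⟨B, hB', rfl, h2⟩ := (pair_mem_val_iff hG hK).1 hb
      exact S.val_congr (h2.mono fun x hx => (pair_mem_graphOn.1 hx).2)

theorem val_W_sUnion {c : C} (hdep : (S.dep c : Set C) ⊆ T) :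
    (ZFSet.sUnion (S.val T (S.W c))) = S.val T (S.cardSet c) := by
  rw [← val_sUnion (S.supp_W hdep)]
  exact congrArg _ (funext fun x => S.sUnion_W c x)

variable {c : C} {T' : Set C} [Small.{u} T']

/-- Adding a coordinate whose resampling is harmless amounts to taking an ultrapower. -/
theorem isUltrapower_insert (hT' : T' = insert c T) (hc : c ∉ T) (hdep : (S.dep c : Set C) ⊆ T)
    (hres : S.Resamp c T) (i : S.model T → S.model T')
    (hi : ∀ F (hF : Supp T F), (i ⟨S.val T F, val_mem_model hF⟩ : ZFSet.{u}) = S.val T' F) :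
    IsUltrapower (S.model T) (S.val T (S.W c)) (S.model T') i := by
  have hW := S.supp_W hdep
  have hI := S.supp_cardSet hdep
  have hTT' : T ⊆ T' := hT' ▸ Set.subset_insert _ _
  refine ⟨val_mem_model hW, isTransClass_model, ?_⟩
  rw [val_W_sUnion hdep]
  choose! G hG using fun f : ZFSet.{u} => fun hf : f ∈ S.model T => hf
  have hGs : ∀ f ∈ S.model T, Supp T (G f) := fun f hf => (hG f hf).1
  have hGv : ∀ f ∈ S.model T, S.val T (G f) = f := fun f hf => (hG f hf).2
  -- A function of the model is represented by some `G f`, and its class is that of x ↦ (G f x)(x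
  -- c): the new coordinate plays the role of the identity.
  let rep : funcsOn (S.model T) (S.val T (S.cardSet c)) → S.model T' := fun f =>
    ⟨S.val T' fun x => app (G f.1 x) (x c), val_mem_model (supp_app hT' (hGs _ f.2.1))⟩
  have hrep : ∀ (R : ZFSet.{u} → ZFSet.{u} → Prop),
      (∀ F H, Supp T F → Supp T H →
        (R (S.val T F) (S.val T H) ↔ ∀ᶠ x in S.filter, R (F x) (H x))) →
      ∀ f g : funcsOn (S.model T) (S.val T (S.cardSet c)),
        (∀ᶠ x in S.filter, R (app (G f.1 x) (x c)) (app (G g.1 x) (x c))) ↔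
          valSet R (S.val T (S.cardSet c)) f g ∈ S.val T (S.W c) := by
    intro R hR f g
    have hf := hGs _ f.2.1
    have hg := hGs _ g.2.1
    have hV : Supp T fun x => valSet R (S.cardSet c x) (G f.1 x) (G g.1 x) :=
      (hI.comp₂ hf Prod.mk).comp₂ hg fun a b => valSet R a.1 a.2 b
    have e : valSet R (S.val T (S.cardSet c)) f g =
        S.val T fun x => valSet R (S.cardSet c x) (G f.1 x) (G g.1 x) := by
      rw [val_valSet hR hI hf hg, hGv _ f.2.1, hGv _ g.2.1]
    -- Resampling replaces evaluation at `x c` by the quantifier over the measure at c.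
    rw [e, val_mem_val_iff hV hW, hres.eventually_coord (P := fun x ζ =>
      R (app (G f.1 x) ζ) (app (G g.1 x) ζ)) (hf.comp₂ hg fun a b ζ => R (app a ζ) (app b ζ)) hc]
    refine eventually_congr ?_
    filter_upwards [eventually_isFunc hI hf (by rw [hGv _ f.2.1]; exact f.2),
      eventually_isFunc hI hg (by rw [hGv _ g.2.1]; exact g.2)] with x h1 h2
    rw [S.mem_W_iff (show valSet R (S.cardSet c x) (G f.1 x) (G g.1 x) ⊆ S.cardSet c x from
      ZFSet.sep_subset)]
    refine eventually_congr ?_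
    filter_upwards [(S.isNormalUF c x).mem] with ζ hζ
    obtain ⟨a, ha, hau⟩ := h1 ζ hζ
    obtain ⟨b, hb, hbu⟩ := h2 ζ hζ
    rw [app_eq ha hau, app_eq hb hbu, valSet, ZFSet.mem_sep]
    constructor
    · exact fun h => ⟨hζ, a, b, ha, hb, h⟩
    · rintro ⟨-, a', b', ha', hb', h⟩
      rwa [hau _ ha', hbu _ hb'] at h
  have hgraph : ∀ (h : (C → ZFSet.{u}) → ZFSet.{u} → ZFSet.{u}) (hh : Supp T h),
      (rep ⟨_, val_graphOn (S := S) hI hh⟩ : ZFSet.{u}) = S.val T' fun x => h x (x c) := by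
    intro h hh
    have hgm := val_mem_model (S := S) (hI.comp₂ hh graphOn)
    refine S.val_congr ?_
    filter_upwards [(val_eq_val_iff (hGs _ hgm) (hI.comp₂ hh graphOn)).1 (hGv _ hgm),
      S.eventually_mem_cardSet c] with x h1 h2
    rw [h1, app_graphOn h2]
  refine ⟨rep, ?_, fun f g => ?_, fun f g => ?_, ?_⟩
  · rintro ⟨_, K, hK, rfl⟩
    -- The preimage is the function ζ ↦ K(x with c set to ζ), whose support is in T.
    refine ⟨⟨_, val_graphOn hI (Supp.curry (c := c) (hT' ▸ hK))⟩, Subtype.ext ?_⟩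
    rw [hgraph _ (Supp.curry (c := c) (hT' ▸ hK))]
    simp
  · rw [← hrep (· = ·) (fun F H hF hH => val_eq_val_iff hF hH), Subtype.ext_iff]
    exact val_eq_val_iff (supp_app hT' (hGs _ f.2.1)) (supp_app hT' (hGs _ g.2.1))
  · rw [← hrep (· ∈ ·) (fun F H hF hH => val_mem_val_iff hF hH)]
    exact val_mem_val_iff (supp_app hT' (hGs _ f.2.1)) (supp_app hT' (hGs _ g.2.1))
  · rintro ⟨_, X, hX, rfl⟩
    have hXc : Supp T fun x (_ : ZFSet.{u}) => X x := hX.comp fun a _ => a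
    refine ⟨⟨_, val_graphOn hI hXc⟩, ?_, Subtype.ext ?_⟩
    · change S.val T (fun x => graphOn (S.cardSet c x) fun _ => X x) = _
      have hG : Supp T fun x => graphOn (S.cardSet c x) fun _ => X x := hI.comp₂ hXc graphOn
      ext z
      rw [mem_val_iff hG, ZFSet.mem_prod]
      constructor
      · rintro ⟨K, hK, h1, rfl⟩
        obtain ⟨Ξ, hΞ, h2⟩ := S.exists_of_eventually
          (P := fun x ξ => ξ ∈ S.cardSet c x ∧ ZFSet.pair ξ (X x) = K x)
          ((hI.comp₂ hX Prod.mk).comp₂ hK fun i k ξ => ξ ∈ i.1 ∧ ZFSet.pair ξ i.2 = k)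
          (h1.mono fun x hx => mem_graphOn.1 hx)
        refine ⟨_, (val_mem_val_iff hΞ hI).2 (h2.mono fun x hx => hx.1), S.val T X, by simp, ?_⟩
        rw [← val_pair hΞ hX]
        exact S.val_congr (h2.mono fun x hx => hx.2.symm)
      · rintro ⟨a, ha, b, hb, rfl⟩
        obtain rfl := ZFSet.mem_singleton.1 hb
        obtain ⟨A, hA, h1, rfl⟩ := (mem_val_iff hI).1 ha
        refine ⟨_, hA.comp₂ hX ZFSet.pair, ?_, val_pair hA hX⟩
        exact h1.mono fun x hx => pair_mem_graphOn.2 ⟨hx, rfl⟩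
    · rw [hi _ hX, hgraph _ hXc]

/-! ### What an ultrapower fixes and what it omits -/

/-- Functions into the elements of `b` are constant modulo `l`. -/
def Rigid (l : Ultrafilter ZFSet.{u}) (b : ZFSet.{u}) : Prop :=
  ∀ h : ZFSet.{u} → ZFSet.{u}, (∀ᶠ ζ in l, h ζ ∈ b) → ∃ a, ∀ᶠ ζ in l, h ζ = a

/-- Hereditarily rigid elements are not moved by the ultrapower. -/
theorem val_eq_of_rigid (hT' : T' = insert c T) (hc : c ∉ T) (hdep : (S.dep c : Set C) ⊆ T)
    (hres : S.Resamp c T) {R : (C → ZFSet.{u}) → ZFSet.{u}}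
    (hRt : ∀ᶠ x in S.filter, (R x).IsTransitive)
    (hR : ∀ᶠ x in S.filter, ∀ b ∈ R x, Rigid (S.meas c x) b)
    (hF : Supp T F) (hFR : ∀ᶠ x in S.filter, F x ∈ R x) : S.val T' F = S.val T F := by
  have hTT' : T ⊆ T' := hT' ▸ Set.subset_insert _ _
  induction F using S.wellFounded_mem.induction with
  | _ F ih =>
  have hsub : ∀ {g : (C → ZFSet.{u}) → ZFSet.{u}}, (∀ᶠ x in S.filter, g x ∈ F x) →
      ∀ᶠ x in S.filter, g x ∈ R x := fun hg => by
    filter_upwards [hg, hFR, hRt] with x h1 h2 h3 using h3 _ h2 h1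
  ext z
  rw [mem_val_iff (hF.mono hTT'), mem_val_iff hF]
  constructor
  · rintro ⟨K, hK, h1, rfl⟩
    have h2 := (eventually_meas_of_eventually hT' hc hres hK hF fun k f _ => k ∈ f).1 h1
    obtain ⟨g, hg, h3⟩ := exists_eq_of_constant hT' hc hdep hres hK (by
      filter_upwards [h2, hFR, hR] with x h4 h5 h6 using h6 _ h5 _ h4)
    have h4 : ∀ᶠ x in S.filter, g x ∈ F x := by
      filter_upwards [h1, h3] with x h5 h6 using h6 ▸ h5
    refine ⟨g, hg, h4, ?_⟩
    rw [← ih g h4 hg (hsub h4)]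
    exact S.val_congr (h3.mono fun x hx => hx.symm)
  · rintro ⟨g, hg, h1, rfl⟩
    exact ⟨g, hg.mono hTT', h1, ih g h1 hg (hsub h1)⟩

theorem val_eq_of_mem_cardSet (hT' : T' = insert c T) (hc : c ∉ T) (hdep : (S.dep c : Set C) ⊆ T)
    (hres : S.Resamp c T) (hF : Supp T F) (hFc : ∀ᶠ x in S.filter, F x ∈ S.cardSet c x) :
    S.val T' F = S.val T F := by
  refine val_eq_of_rigid hT' hc hdep hres
    (Eventually.of_forall fun x => (S.isOrdinal_cardSet c x).isTransitive)
    (Eventually.of_forall fun x b hb h hh => ?_) hF hFc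
  obtain ⟨a, -, ha⟩ := (S.completeBelow c x).exists_eq (card_lt_of_mem_ord hb) hh
  exact ⟨a, ha⟩

/-- A subset `A` of the critical point is represented by `A ∩ ζ`. -/
theorem val_inter_coord (hT' : T' = insert c T) (hc : c ∉ T) (hdep : (S.dep c : Set C) ⊆ T)
    (hres : S.Resamp c T) (hF : Supp T F) (hFc : ∀ᶠ x in S.filter, F x ⊆ S.cardSet c x) :
    S.val T' (fun x => F x ∩ x c) = S.val T F := by
  have hTT' : T ⊆ T' := hT' ▸ Set.subset_insert _ _
  have hcT' : c ∈ T' := hT' ▸ Set.mem_insert _ _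
  have hi : Supp T' fun x => F x ∩ x c := (hF.mono hTT').comp₂ (Supp.coord hcT') (· ∩ ·)
  ext z
  rw [mem_val_iff hi, mem_val_iff hF]
  constructor
  · rintro ⟨K, hK, h1, rfl⟩
    have h2 := (eventually_meas_of_eventually hT' hc hres hK hF fun k f ζ => k ∈ f ∩ ζ).1 h1
    -- An element of F x ∩ ζ is regressive in ζ, so normality makes it constant.
    obtain ⟨g, hg, h3⟩ := exists_eq_of_constant hT' hc hdep hres hK (by
      filter_upwards [h2] with x h4
      exact (S.isNormalUF c x).normal _ (h4.mono fun ζ hζ => (ZFSet.mem_inter.1 hζ).2))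
    have h4 : ∀ᶠ x in S.filter, g x ∈ F x := by
      filter_upwards [h1, h3] with x h5 h6 using h6 ▸ (ZFSet.mem_inter.1 h5).1
    refine ⟨g, hg, h4, ?_⟩
    rw [← val_eq_of_mem_cardSet hT' hc hdep hres hg (by
      filter_upwards [h4, hFc] with x h5 h6 using h6 h5)]
    exact S.val_congr (h3.mono fun x hx => hx.symm)
  · rintro ⟨g, hg, h1, rfl⟩
    have h2 : ∀ᶠ x in S.filter, g x ∈ S.cardSet c x := by
      filter_upwards [h1, hFc] with x h5 h6 using h6 h5
    refine ⟨g, hg.mono hTT', ?_, val_eq_of_mem_cardSet hT' hc hdep hres hg h2⟩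
    have h3 : ∀ᶠ x in S.filter, g x ∈ x c := by
      rw [hres.eventually_coord (P := fun x ζ => g x ∈ ζ) (hg.comp fun a ζ => a ∈ ζ) hc]
      exact h2.mono fun x hx => (S.isNormalUF c x).tail _ hx
    filter_upwards [h1, h3] with x h4 h5 using ZFSet.mem_inter.2 ⟨h4, h5⟩

/-- The new coordinate represents the old critical point: take the whole cardinal as the subset in
`val_inter_coord`, and note that its intersection with ζ is ζ. -/
theorem val_coord (hT' : T' = insert c T) (hc : c ∉ T) (hdep : (S.dep c : Set C) ⊆ T)
    (hres : S.Resamp c T) : S.val T' (fun x => x c) = S.val T (S.cardSet c) := by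
  rw [← val_inter_coord hT' hc hdep hres (S.supp_cardSet hdep)
    (Eventually.of_forall fun x => fun _ h => h)]
  refine S.val_congr ((S.eventually_mem_cardSet c).mono fun x hx => ?_)
  rw [ZFSet.inter_eq_right_of_subset ((S.isOrdinal_cardSet c x).subset_of_mem hx)]

theorem val_mem_val_insert_iff (hT' : T' = insert c T) (hc : c ∉ T)
    (hdep : (S.dep c : Set C) ⊆ T) (hres : S.Resamp c T) {K : (C → ZFSet.{u}) → ZFSet.{u}}
    (hK : Supp T' K) (hF : Supp T F) (hFc : ∀ᶠ x in S.filter, F x ⊆ S.cardSet c x) :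
    S.val T F ∈ S.val T' K ↔ ∀ᶠ x in S.filter, ∀ᶠ ζ in S.meas c x,
      F x ∩ ζ ∈ K (Function.update x c ζ) := by
  have hTT' : T ⊆ T' := hT' ▸ Set.subset_insert _ _
  have hcT' : c ∈ T' := hT' ▸ Set.mem_insert _ _
  rw [← val_inter_coord hT' hc hdep hres hF hFc,
    val_mem_val_iff ((hF.mono hTT').comp₂ (Supp.coord hcT') (· ∩ ·)) hK]
  exact eventually_meas_of_eventually hT' hc hres hK hF fun k f ζ => f ∩ ζ ∈ k

/-- A normal measure that concentrates on ordinals without normal measures is not an element of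
its ultrapower. -/
theorem val_W_notMem_model (hT' : T' = insert c T) (hc : c ∉ T) (hdep : (S.dep c : Set C) ⊆ T)
    (hres : S.Resamp c T)
    (h0 : ∀ x, ∀ᶠ ζ in S.meas c x, ¬ ∃ w, IsNormalUF ζ w) :
    S.val T (S.W c) ∉ S.model T' := by
  rintro ⟨K, hK, hKW⟩
  have hcur : Supp T fun x ζ => K (Function.update x c ζ) := Supp.curry (hT' ▸ hK)
  -- A witness A that K does not represent the measure. One exists at every x, since otherwise
  -- almost every ζ would carry a normal ultrafilter; choosing it from finitely many coordinates
  -- puts it into the model.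
  let P : ZFSet.{u} × Ultrafilter ZFSet.{u} → (ZFSet.{u} → ZFSet.{u}) → ZFSet.{u} → Prop :=
    fun a k A => A ⊆ a.1 ∧ ¬ ((∀ᶠ γ in a.2, γ ∈ A) ↔ ∀ᶠ ζ in a.2, A ∩ ζ ∈ k ζ)
  obtain ⟨A, hA, hAP⟩ := S.exists_of_eventually (T := T)
    (P := fun x => P (S.cardSet c x, S.meas c x) fun ζ => K (Function.update x c ζ))
    (((S.supp_cardSet hdep).comp₂ (S.supp_meas hdep) Prod.mk).comp₂ hcur P)
    (Eventually.of_forall fun x => by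
      by_contra! hcon
      obtain ⟨ζ, h1, h2⟩ := ((h0 x).and ((S.isNormalUF c x).eventually_exists_of_represents
        (S.isOrdinal_cardSet c x) (S.isNormalUF c x) (fun ζ => K (Function.update x c ζ))
        fun A hA => by
          by_contra hne
          exact hcon A ⟨hA, hne⟩)).exists
      exact h1 h2)
  have hAc : ∀ᶠ x in S.filter, A x ⊆ S.cardSet c x := hAP.mono fun x hx => hx.1
  have h1 := val_mem_val_insert_iff hT' hc hdep hres hK hA hAc
  rw [hKW, val_mem_val_iff hA (S.supp_W hdep)] at h1
  have h2 : (∀ᶠ x in S.filter, A x ∈ S.W c x) ↔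
      ∀ᶠ x in S.filter, ∀ᶠ γ in S.meas c x, γ ∈ A x :=
    eventually_congr (hAc.mono fun x hx => S.mem_W_iff hx)
  rw [h2] at h1
  have hs1 : Supp T fun x => ∀ᶠ γ in S.meas c x, γ ∈ A x :=
    (S.supp_meas hdep).comp₂ hA fun l a => ∀ᶠ γ in (l : Filter ZFSet.{u}), γ ∈ a
  have hs2 : Supp T fun x => ∀ᶠ ζ in S.meas c x, A x ∩ ζ ∈ K (Function.update x c ζ) :=
    ((S.supp_meas hdep).comp₂ hA Prod.mk).comp₂ hcur fun l k =>
      ∀ᶠ ζ in (l.1 : Filter ZFSet.{u}), l.2 ∩ ζ ∈ k ζ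
  -- The two sides of the equivalence disagree at almost every x, yet are equivalent as statements
  -- about the filter. Both are decided, a contradiction.
  rcases S.em_of_supp hs1 with h3 | h3
  · obtain ⟨x, h4, h5, h6⟩ := (h3.and ((h1.1 h3).and hAP)).exists
    exact h6.2 ⟨fun _ => h5, fun _ => h4⟩
  · rcases S.em_of_supp hs2 with h4 | h4
    · obtain ⟨x, h5, h6⟩ := (h3.and (h1.2 h4)).exists
      exact h5 h6
    · obtain ⟨x, h5, h6, h7⟩ := (h3.and (h4.and hAP)).exists
      exact h7.2 ⟨fun h => absurd h h5, fun h => absurd h h6⟩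

end System

theorem IsMeasure.uf_eq {κ κ' : Cardinal.{u}} {W W' : ZFSet.{u}} (h : IsMeasure κ W)
    (h' : IsMeasure κ' W') (e : W = W') : h.uf = h'.uf := by
  subst e
  obtain rfl := h.card_eq h'
  rfl

/-! ### Mitchell order zero -/

/-- The system consisting of a single normal measure. -/
def singleSystem {κ : Cardinal.{u}} {W : ZFSet.{u}} (h : IsNormalMeasure κ W) :
    System.{u} PUnit.{1} where
  card _ _ := κ
  W _ _ := W
  normal _ _ := h
  dep _ := ∅
  dep_lt _ := by simp
  W_dep _ _ _ _ := rfl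
  bound := κ
  card_le _ _ := le_rfl

theorem IsUltrapower.exists_univ {M N : Set ZFSet.{u}} {W : ZFSet.{u}} {i : M → N}
    (h : IsUltrapower M W N i) (hM : M = Set.univ) :
    ∃ i' : ↥(Set.univ : Set ZFSet.{u}) → N, IsUltrapower Set.univ W N i' := by
  subst hM
  exact ⟨i, h⟩

/-- Any normal measure on κ in the ultrapower, not only `W`, would be represented by some K, and
then almost every ζ would carry a normal ultrafilter. -/
theorem IsNormalMeasure.mitchellOrderZero {κ : Cardinal.{u}} {W : ZFSet.{u}}
    (h : IsNormalMeasure κ W)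
    (h0 : ∀ᶠ ζ in h.toIsMeasure.uf, ¬ ∃ w, IsNormalUF ζ w) : MitchellOrderZero κ W := by
  let S := singleSystem h
  let c : PUnit.{1} := PUnit.unit
  have hT' : ({c} : Set PUnit.{1}) = insert c ∅ := by simp
  have hc : c ∉ (∅ : Set PUnit.{1}) := Set.notMem_empty c
  have hdep : (S.dep c : Set PUnit.{1}) ⊆ ∅ := by simp [S, singleSystem]
  have hres : S.Resamp c ∅ := S.resamp_of_lt (by simp)
  have hult := System.isUltrapower_insert hT' hc hdep hres
    (fun y => ⟨S.val {c} fun _ => y, System.val_mem_model (Supp.const _)⟩) fun F hF => by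
      have hFc : F = fun _ => F fun _ => ∅ := funext fun x => hF.empty _ _
      change S.val {c} (fun _ => S.val ∅ F) = S.val {c} F
      rw [hFc, System.val_empty_const]
  have hW : S.val ∅ (S.W c) = W := System.val_empty_const W
  rw [hW] at hult
  obtain ⟨i, hi⟩ := hult.exists_univ System.model_empty
  refine ⟨S.model {c}, i, hi, ?_⟩
  rintro _ ⟨K, hK, rfl⟩ hN
  have hupd : ∀ (inst : DecidableEq PUnit.{1}) (x : PUnit.{1} → ZFSet.{u}) ζ,
      @Function.update _ _ inst x c ζ = fun _ => ζ := fun _ x ζ => funext fun d => by simp [c]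
  have hmeas : ∀ x, S.meas c x = h.toIsMeasure.uf := fun _ => rfl
  have hrep := h.isNormalUF.eventually_exists_of_represents (ZFSet.isOrdinal_toZFSet _)
    hN.isNormalUF (fun ζ => K fun _ => ζ) fun A hA => by
      rw [← hN.toIsMeasure.mem_iff hA]
      have := System.val_mem_val_insert_iff hT' hc hdep hres hK (Supp.const A)
        (Eventually.of_forall fun _ => hA)
      rw [System.val_empty_const] at this
      rw [this]
      simp only [hupd, hmeas]
      exact eventually_const (f := S.filter)
  obtain ⟨ζ, h1, h2⟩ := (h0.and hrep).exists
  exact h1 h2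

/-! ### The coordinates and the iterations -/

/-- The index set of the iterations: `(α, false)` and `(α, true)` stand for the first and the
second ultrapower taken at stage `α`. -/
abbrev Coord : Type (u + 1) := Ordinal.{u} ×ₗ Bool

namespace Coord

/-- The coordinate of the first ultrapower at stage `α`. -/
def fst (α : Ordinal.{u}) : Coord.{u} := toLex (α, false)

/-- The coordinate of the second ultrapower at stage `α`. -/
def snd (α : Ordinal.{u}) : Coord.{u} := toLex (α, true)

theorem fst_or_snd (c : Coord.{u}) : (∃ α, c = fst α) ∨ ∃ α, c = snd α := by
  obtain ⟨⟨α, b⟩, rfl⟩ := toLex.surjective c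
  cases b
  · exact Or.inl ⟨α, rfl⟩
  · exact Or.inr ⟨α, rfl⟩

theorem fst_lt_snd (α : Ordinal.{u}) : fst α < snd α :=
  Prod.Lex.toLex_lt_toLex.2 (Or.inr ⟨rfl, Bool.false_lt_true⟩)

theorem lt_of_ofLex_lt {c d : Coord.{u}} (h : (ofLex c).1 < (ofLex d).1) : c < d :=
  Prod.Lex.lt_iff.2 (Or.inl h)

theorem fst_injective : Function.Injective fst.{u} := fun _ _ h =>
  congrArg (fun c : Coord.{u} => (ofLex c).1) h

theorem snd_injective : Function.Injective snd.{u} := fun _ _ h =>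
  congrArg (fun c : Coord.{u} => (ofLex c).1) h

theorem fst_ne_snd (α β : Ordinal.{u}) : fst α ≠ snd β := fun h =>
  Bool.false_ne_true (congrArg (fun c : Coord.{u} => (ofLex c).2) h)

end Coord

open Coord

/-- A normal measure `U` on `κ` and normal measures `v i` of order zero on distinct cardinals
above `κ`, for `i < κ`. -/
structure MeasureSeq (κ : Cardinal.{u}) where
  μ : Set.Iio κ.ord → Cardinal.{u}
  U : ZFSet.{u}
  v : Set.Iio κ.ord → ZFSet.{u}
  normal_U : IsNormalMeasure κ U
  injective : Function.Injective μ
  lt_μ : ∀ i, κ < μ i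
  normal_v : ∀ i, IsNormalMeasure (μ i) (v i)
  orderZero : ∀ i, ∀ᶠ ζ in (normal_v i).toIsMeasure.uf, ¬ ∃ w, IsNormalUF ζ w

namespace MeasureSeq

variable {κ : Cardinal.{u}} (D : MeasureSeq κ)

/-- The index given by an element of `κ`. -/
noncomputable def index (z : ZFSet.{u}) : Set.Iio κ.ord :=
  if h : z.rank < κ.ord then ⟨z.rank, h⟩ else ⟨0, D.normal_U.toIsMeasure.ord_pos⟩

theorem toZFSet_index {z : ZFSet.{u}} (hz : z ∈ κ.ord.toZFSet) :
    (D.index z : Ordinal.{u}).toZFSet = z := by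
  obtain ⟨a, ha, rfl⟩ := Ordinal.mem_toZFSet_iff.1 hz
  rw [index, dif_pos (by rwa [Ordinal.rank_toZFSet])]
  simp

/-- The system of measures used by the iterations. -/
noncomputable def system : System.{u} Coord.{u} where
  card c x := if (ofLex c).2 then D.μ (D.index (x (fst (ofLex c).1))) else κ
  W c x := if (ofLex c).2 then D.v (D.index (x (fst (ofLex c).1))) else D.U
  normal c x := by
    by_cases h : (ofLex c).2 = true
    · rw [if_pos h, if_pos h]
      exact D.normal_v _
    · rw [if_neg h, if_neg h]
      exact D.normal_U
  dep c := if (ofLex c).2 then {fst (ofLex c).1} else ∅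
  dep_lt c d hd := by
    rcases fst_or_snd c with ⟨α, rfl⟩ | ⟨α, rfl⟩
    · simp [fst] at hd
    · have : d = fst α := by simpa [snd] using hd
      exact this ▸ fst_lt_snd α
  W_dep c x y hxy := by
    by_cases h : (ofLex c).2 = true
    · simp only [h, if_true] at hxy ⊢
      rw [hxy _ (by simp)]
    · simp only [h]
      rfl
  bound := max κ (sSup (Set.range D.μ))
  card_le c x := by
    by_cases h : (ofLex c).2 = true
    · rw [if_pos h]
      exact (le_csSup bddAbove_of_small (Set.mem_range_self _)).trans (le_max_right _ _)
    · rw [if_neg h]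
      exact le_max_left _ _

theorem W_snd (α : Ordinal.{u}) (x : Coord.{u} → ZFSet.{u}) :
    D.system.W (snd α) x = D.v (D.index (x (fst α))) := rfl

theorem card_snd (α : Ordinal.{u}) (x : Coord.{u} → ZFSet.{u}) :
    D.system.card (snd α) x = D.μ (D.index (x (fst α))) := rfl

theorem dep_fst (α : Ordinal.{u}) : D.system.dep (fst α) = ∅ := rfl

theorem dep_snd (α : Ordinal.{u}) : D.system.dep (snd α) = {fst α} := rfl

theorem orderZero_snd (α : Ordinal.{u}) (x : Coord.{u} → ZFSet.{u}) :
    ∀ᶠ ζ in D.system.meas (snd α) x, ¬ ∃ w, IsNormalUF ζ w := by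
  have : D.system.meas (snd α) x = (D.normal_v (D.index (x (fst α)))).toIsMeasure.uf :=
    IsMeasure.uf_eq _ _ (D.W_snd α x)
  rw [this]
  exact D.orderZero _

theorem eventually_fst_mem (α : Ordinal.{u}) :
    ∀ᶠ x in D.system.filter, x (fst α) ∈ κ.ord.toZFSet :=
  D.system.eventually_mem_cardSet (fst α)

/-- The first coordinates increase with the stage, because each measure contains all tails of κ. -/
theorem eventually_fst_mem_fst {α β : Ordinal.{u}} (h : α < β) :
    ∀ᶠ x in D.system.filter, x (fst α) ∈ x (fst β) := by
  have := D.system.eventually_coord (fst β)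
    (P := fun x ζ => x (fst α) ∈ κ.ord.toZFSet → x (fst α) ∈ ζ) (fun x y hxy => by
      have : x (fst α) = y (fst α) := hxy _ (lt_of_ofLex_lt h)
      simp only [this]) (fun x => by
      by_cases hx : x (fst α) ∈ κ.ord.toZFSet
      · exact ((D.system.isNormalUF (fst β) x).tail _ hx).mono fun ζ hζ _ => hζ
      · exact Eventually.of_forall fun ζ h => absurd h hx)
  filter_upwards [this, D.eventually_fst_mem α] with x h1 h2 using h1 h2

theorem eventually_card_ne {α β : Ordinal.{u}} (h : α ≠ β) :
    ∀ᶠ x in D.system.filter, D.system.card (snd α) x ≠ D.system.card (snd β) x := by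
  wlog hlt : α < β generalizing α β
  · exact (this h.symm (lt_of_le_of_ne (not_lt.1 hlt) h.symm)).mono fun x hx => hx.symm
  filter_upwards [D.eventually_fst_mem α, D.eventually_fst_mem β, D.eventually_fst_mem_fst hlt]
    with x h1 h2 h3 h4
  have h5 : D.index (x (fst α)) = D.index (x (fst β)) := D.injective h4
  rw [← D.toZFSet_index h1, ← D.toZFSet_index h2, h5] at h3
  exact ZFSet.mem_irrefl _ h3

/-- No later coordinate depends on this one, and all later measures commute with it: first
coordinates concentrate on κ, below every μ i, and second coordinates of other stages almost surely
use other cardinals. -/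
theorem resamp_snd (α : Ordinal.{u}) : D.system.Resamp (snd α) Set.univ := by
  refine D.system.resamp_univ (fun d _ hd => ?_) fun d hd => ?_
  · rcases fst_or_snd d with ⟨β, rfl⟩ | ⟨β, rfl⟩
    · simp [dep_fst] at hd
    · rw [dep_snd, Finset.mem_singleton] at hd
      exact fst_ne_snd _ _ hd.symm
  · have hsnd := fun (γ : Ordinal.{u}) x => D.system.completeBelow (snd γ) x
    have hmem := fun (c : Coord.{u}) x => (D.system.isNormalUF c x).mem
    have hcard : ∀ (c : Coord.{u}) x, (D.system.cardSet c x).card = D.system.card c x :=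
      fun c x => by rw [System.cardSet, Ordinal.card_toZFSet, Cardinal.card_ord]
    rcases fst_or_snd d with ⟨β, rfl⟩ | ⟨β, rfl⟩
    · refine Eventually.of_forall fun x => ?_
      refine ufCommute_of_card_lt (hmem _ x) ?_ (hsnd α x)
      rw [hcard, card_snd]
      exact D.lt_μ _
    · have hne : α ≠ β := fun h => hd.ne (h ▸ rfl)
      filter_upwards [D.eventually_card_ne hne] with x hx
      rcases lt_or_gt_of_ne hx with h | h
      · exact (ufCommute_of_card_lt (hmem _ x) (by rwa [hcard]) (hsnd β x)).symm
      · exact ufCommute_of_card_lt (hmem _ x) (by rwa [hcard]) (hsnd α x)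

/-- The coordinates used by the iteration along `f` before stage `α`. -/
def coords (f : Ordinal.{u} → Bool) (α : Ordinal.{u}) : Set Coord.{u} :=
  {c | (ofLex c).1 < α ∧ ((ofLex c).2 = true → f (ofLex c).1 = true)}

theorem fst_mem_coords {f : Ordinal.{u} → Bool} {α β : Ordinal.{u}} :
    fst β ∈ coords f α ↔ β < α := by
  simp [coords, fst]

theorem snd_mem_coords {f : Ordinal.{u} → Bool} {α β : Ordinal.{u}} :
    snd β ∈ coords f α ↔ β < α ∧ f β = true := by
  simp [coords, snd]

instance small_coords (f : Ordinal.{u} → Bool) (α : Ordinal.{u}) : Small.{u} (coords f α) := by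
  let e : coords f α → Set.Iio α × Bool := fun c => (⟨(ofLex c.1).1, c.2.1⟩, (ofLex c.1).2)
  refine small_of_injective (f := e) fun c d h => Subtype.ext ?_
  have h1 : (ofLex c.1).1 = (ofLex d.1).1 := congrArg (fun p => (p.1 : Ordinal.{u})) h
  have h2 : (ofLex c.1).2 = (ofLex d.1).2 := congrArg (fun p => p.2) h
  exact ofLex.injective (Prod.ext h1 h2)

theorem coords_zero (f : Ordinal.{u} → Bool) : coords f 0 = ∅ := by
  ext c
  simp [coords]

theorem coords_mono (f : Ordinal.{u} → Bool) {α β : Ordinal.{u}} (h : α ≤ β) :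
    coords f α ⊆ coords f β :=
  fun _ hc => ⟨hc.1.trans_le h, hc.2⟩

theorem coords_succ_false {f : Ordinal.{u} → Bool} {α : Ordinal.{u}} (h : f α = false) :
    coords f (α + 1) = insert (fst α) (coords f α) := by
  ext c
  rcases fst_or_snd c with ⟨β, rfl⟩ | ⟨β, rfl⟩
  · rw [Set.mem_insert_iff, fst_mem_coords, fst_mem_coords, fst_injective.eq_iff,
      Order.lt_add_one_iff, le_iff_eq_or_lt]
  · rw [Set.mem_insert_iff, snd_mem_coords, snd_mem_coords, Order.lt_add_one_iff,
      le_iff_eq_or_lt]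
    have := (fst_ne_snd α β).symm
    constructor
    · rintro ⟨rfl | h1, h2⟩
      · simp [h] at h2
      · exact Or.inr ⟨h1, h2⟩
    · rintro (h1 | h1)
      · exact absurd h1 this
      · exact ⟨Or.inr h1.1, h1.2⟩

theorem coords_succ_true {f : Ordinal.{u} → Bool} {α : Ordinal.{u}} (h : f α = true) :
    coords f (α + 1) = insert (snd α) (insert (fst α) (coords f α)) := by
  ext c
  rcases fst_or_snd c with ⟨β, rfl⟩ | ⟨β, rfl⟩
  · simp only [Set.mem_insert_iff, fst_mem_coords, fst_injective.eq_iff,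
      Order.lt_add_one_iff, le_iff_eq_or_lt, fst_ne_snd, false_or]
  · simp only [Set.mem_insert_iff, snd_mem_coords, snd_injective.eq_iff, Order.lt_add_one_iff,
      le_iff_eq_or_lt, (fst_ne_snd _ _).symm, false_or]
    constructor
    · rintro ⟨rfl | h1, h2⟩
      · exact Or.inl rfl
      · exact Or.inr ⟨h1, h2⟩
    · rintro (rfl | h1)
      · exact ⟨Or.inl rfl, h⟩
      · exact ⟨Or.inr h1.1, h1.2⟩

theorem fst_notMem_coords (f : Ordinal.{u} → Bool) (α : Ordinal.{u}) : fst α ∉ coords f α := by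
  simp [fst_mem_coords]

theorem resamp_fst (f : Ordinal.{u} → Bool) (α : Ordinal.{u}) :
    D.system.Resamp (fst α) (coords f α) :=
  D.system.resamp_of_lt fun _ hd => lt_of_ofLex_lt hd.1

/-- The inclusion embedding between models. -/
noncomputable def incl {T T' : Set Coord.{u}} [Small.{u} T] [Small.{u} T'] (h : T ⊆ T') :
    D.system.model T ↪ₑ[setLang] D.system.model T' :=
  System.embedding id tendsto_id fun _ hF => hF.mono h

theorem incl_val {T T' : Set Coord.{u}} [Small.{u} T] [Small.{u} T'] (h : T ⊆ T')
    {F : (Coord.{u} → ZFSet.{u}) → ZFSet.{u}} (hF : Supp T F) :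
    (D.incl h ⟨D.system.val T F, System.val_mem_model hF⟩ : ZFSet.{u}) = D.system.val T' F :=
  System.embedding_val _ _ hF

theorem incl_zero (f : Ordinal.{u} → Bool) {T : Set Coord.{u}} [Small.{u} T]
    (h : coords f 0 ⊆ T) (a : ZFSet.{u}) (ha : a ∈ D.system.model (coords f 0)) :
    (D.incl h ⟨a, ha⟩ : ZFSet.{u}) = D.system.val T fun _ => a := by
  rw [← D.incl_val h (Supp.const a)]
  congr 3
  have : coords f 0 = ∅ := coords_zero f
  rw! [this]
  exact System.val_empty_const a |>.symm

/-- The iteration along `f`. -/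
noncomputable def iteration (f : Ordinal.{u} → Bool) (θ : Ordinal.{u}) :
    Iteration κ D.U (seqSet κ D.v) θ f where
  model α := D.system.model (coords f α)
  map α β h _ := D.incl (coords_mono f h)
  transitive α _ := System.isTransClass_model
  zero := by rw [coords_zero]; exact System.model_empty
  map_refl := by
    rintro α h ⟨_, F, hF, rfl⟩
    exact Subtype.ext (D.incl_val _ hF)
  map_comp := by
    rintro α β γ h h' hγ ⟨_, F, hF, rfl⟩
    refine Subtype.ext ?_
    have h1 : D.incl (coords_mono f h) ⟨D.system.val (coords f α) F, System.val_mem_model hF⟩ =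
        ⟨D.system.val (coords f β) F, System.val_mem_model (hF.mono (coords_mono f h))⟩ :=
      Subtype.ext (D.incl_val _ hF)
    have h2 := D.incl_val (coords_mono f (h.trans h')) hF
    refine Eq.trans ?_ h2.symm
    exact (congrArg (fun y => (D.incl (coords_mono f h') y : ZFSet.{u})) h1).trans
      (D.incl_val _ (hF.mono (coords_mono f h)))
  succ_false α h hα hf := by
    rw [D.incl_zero]
    exact System.isUltrapower_insert (c := fst α) (coords_succ_false hf) (fst_notMem_coords f α)
      (by simp [dep_fst]) (D.resamp_fst f α) _ fun F hF => D.incl_val _ hF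
  succ_true α h hα hf := by
    have hc := fst_notMem_coords f α
    have hd : (D.system.dep (fst α) : Set Coord.{u}) ⊆ coords f α := by simp [dep_fst]
    have hd' : (D.system.dep (snd α) : Set Coord.{u}) ⊆ insert (fst α) (coords f α) := by
      simp [dep_snd]
    have hc' : snd α ∉ insert (fst α) (coords f α) := by
      rw [Set.mem_insert_iff, snd_mem_coords]
      rintro (h | h)
      · exact fst_ne_snd _ _ h.symm
      · exact lt_irrefl _ h.1
    have hsub : insert (fst α) (coords f α) ⊆ coords f (α + 1) := by
      rw [coords_succ_true hf]
      exact Set.subset_insert _ _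
    refine ⟨D.system.model (insert (fst α) (coords f α)), D.incl (Set.subset_insert _ _),
      D.system.val (insert (fst α) (coords f α)) (D.system.W (snd α)), D.incl hsub, ?_, ?_, ?_, ?_⟩
    · rw [D.incl_zero]
      exact System.isUltrapower_insert (c := fst α) rfl hc hd (D.resamp_fst f α) _
        fun F hF => D.incl_val _ hF
    · have h1 : D.incl (coords_mono f (show 0 ≤ α from bot_le)) ⟨seqSet κ D.v, by
          rw [coords_zero, System.model_empty]; trivial⟩ =
          ⟨D.system.val (coords f α) fun _ => seqSet κ D.v, System.val_mem_model (Supp.const _)⟩ :=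
        Subtype.ext (D.incl_zero f _ _ _)
      rw [D.incl_zero, h1, D.incl_val _ (Supp.const _)]
      -- j(κ) at stage α is the class of the first coordinate in the next ultrapower. So the entry
      -- with index j(κ) is represented by the measure that this coordinate selects.
      have h2 : (D.system.val (coords f α) fun _ => κ.ord.toZFSet) =
          D.system.val (insert (fst α) (coords f α)) fun x => x (fst α) :=
        (System.val_coord rfl hc hd (D.resamp_fst f α)).symm
      have h3 : Supp (insert (fst α) (coords f α)) fun x : Coord.{u} → ZFSet.{u} => x (fst α) :=
        Supp.coord (Set.mem_insert _ _)
      have h4 := D.system.supp_W hd'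
      rw [h2, ← System.val_pair h3 h4,
        System.val_mem_val_iff (h3.comp₂ h4 ZFSet.pair) (Supp.const _)]
      filter_upwards [D.eventually_fst_mem α] with x hx
      rw [W_snd, seqSet, ZFSet.mem_range]
      exact ⟨D.index (x (fst α)), by rw [D.toZFSet_index hx]⟩
    · exact System.isUltrapower_insert (c := snd α) (coords_succ_true hf) hc' hd'
        ((D.resamp_snd α).mono (Set.subset_univ _)) _ fun F hF => D.incl_val _ hF
    · rintro ⟨_, F, hF, rfl⟩
      have h1 : D.incl (Set.subset_insert (fst α) (coords f α))
          ⟨D.system.val (coords f α) F, System.val_mem_model hF⟩ =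
          ⟨_, System.val_mem_model (hF.mono (Set.subset_insert _ _))⟩ :=
        Subtype.ext (D.incl_val _ hF)
      refine Subtype.ext ((D.incl_val _ hF).trans ?_)
      rw [h1, D.incl_val _ (hF.mono (Set.subset_insert _ _))]
  limit := by
    rintro α hα hlim ⟨_, F, ⟨s, hs, hF⟩, rfl⟩
    -- A finite support below a limit stage is already contained in an earlier one.
    let β : Ordinal.{u} := s.sup fun c => Order.succ (ofLex c).1
    have hβ : β < α := (Finset.sup_lt_iff hlim.bot_lt).2 fun c hc => hlim.succ_lt (hs hc).1
    have hsup : Supp (coords f β) F := by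
      refine ⟨s, fun c hc => ⟨?_, (hs hc).2⟩, hF⟩
      exact (Order.lt_succ _).trans_le (Finset.le_sup (f := fun c => Order.succ (ofLex c).1) hc)
    exact ⟨β, hβ, ⟨_, System.val_mem_model hsup⟩, Subtype.ext (D.incl_val _ hsup)⟩

end MeasureSeq

/-! ### Distinctness of the models -/

theorem CompleteBelow.rigid {l : Ultrafilter ZFSet.{u}} {κ : Cardinal.{u}}
    (h : CompleteBelow l κ) {b : ZFSet.{u}} (hb : b.card < κ) : System.Rigid l b := fun f hf => by
  obtain ⟨a, -, ha⟩ := h.exists_eq hb hf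
  exact ⟨a, ha⟩

/-- Completeness is applied to the points of B, deciding y ∈ f ζ for each y. No bound on the size of
the power set is needed. -/
theorem CompleteBelow.rigid_of_subset_powerset {l : Ultrafilter ZFSet.{u}} {κ : Cardinal.{u}}
    (h : CompleteBelow l κ) {b B : ZFSet.{u}} (hb : b ⊆ ZFSet.powerset B) (hB : B.card < κ) :
    System.Rigid l b := fun f hf => by
  refine ⟨B.sep fun y => ∀ᶠ ζ in l, y ∈ f ζ, ?_⟩
  have := h B hB (fun y ζ => y ∈ f ζ ↔ ∀ᶠ ζ in l, y ∈ f ζ) fun y _ => by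
    by_cases hy : ∀ᶠ ζ in l, y ∈ f ζ
    · exact hy.mono fun ζ hζ => ⟨fun _ => hy, fun _ => hζ⟩
    · exact (Ultrafilter.eventually_not.2 hy).mono fun ζ hζ =>
        ⟨fun h => absurd h hζ, fun h => absurd h hy⟩
  filter_upwards [this, hf] with ζ h1 h2
  ext y
  rw [ZFSet.mem_sep]
  exact ⟨fun hy => ⟨ZFSet.mem_powerset.1 (hb h2) hy, (h1 y (ZFSet.mem_powerset.1 (hb h2) hy)).1 hy⟩,
    fun hy => (h1 y hy.1).2 hy.2⟩

namespace MeasureSeq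

variable {κ : Cardinal.{u}} (D : MeasureSeq κ)

/-- The sequence that is `0` exactly at `ξ`. -/
noncomputable def omitAt (ξ : Ordinal.{u}) (β : Ordinal.{u}) : Bool := decide (β ≠ ξ)

theorem snd_mem_coords_omitAt {ξ θ β : Ordinal.{u}} :
    snd β ∈ coords (omitAt ξ) θ ↔ β < θ ∧ β ≠ ξ := by
  simp [snd_mem_coords, omitAt]

theorem coords_omitAt_eq {ξ η θ : Ordinal.{u}} (hη : η < θ) (hne : ξ ≠ η) :
    coords (omitAt ξ) θ = insert (snd η) (coords (omitAt ξ) θ ∩ coords (omitAt η) θ) := by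
  ext c
  rcases fst_or_snd c with ⟨β, rfl⟩ | ⟨β, rfl⟩
  · simp [fst_mem_coords, fst_ne_snd]
  · simp only [Set.mem_insert_iff, Set.mem_inter_iff, snd_mem_coords_omitAt, snd_injective.eq_iff]
    constructor
    · rintro ⟨h1, h2⟩
      by_cases h3 : β = η
      · exact Or.inl h3
      · exact Or.inr ⟨⟨h1, h2⟩, h1, h3⟩
    · rintro (rfl | h)
      · exact ⟨hη, hne.symm⟩
      · exact h.1

/-- The measure of stage ξ, computed in the model on the common coordinates, separates the two: the
ultrapower on the larger cardinal keeps it, its own ultrapower loses it. -/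
theorem model_omitAt_ne_of_card_lt {ξ η θ : Ordinal.{u}} (hξ : ξ < θ) (hη : η < θ) (hne : ξ ≠ η)
    (hlt : ∀ᶠ x in D.system.filter, D.system.card (snd ξ) x < D.system.card (snd η) x) :
    D.system.model (coords (omitAt ξ) θ) ≠ D.system.model (coords (omitAt η) θ) := by
  set T₀ := coords (omitAt ξ) θ ∩ coords (omitAt η) θ with hT₀
  have : Small.{u} T₀ := small_subset Set.inter_subset_left
  have e1 := coords_omitAt_eq hη hne
  have e2 : coords (omitAt η) θ = insert (snd ξ) T₀ := by
    rw [coords_omitAt_eq hξ hne.symm, Set.inter_comm]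
  have hd : ∀ {ζ : Ordinal.{u}}, ζ < θ → (D.system.dep (snd ζ) : Set Coord.{u}) ⊆ T₀ := by
    intro ζ hζ
    rw [dep_snd, Finset.coe_singleton, Set.singleton_subset_iff]
    exact ⟨fst_mem_coords.2 hζ, fst_mem_coords.2 hζ⟩
  have hξT : snd ξ ∉ T₀ := fun h => (snd_mem_coords_omitAt.1 h.1).2 rfl
  have hηT : snd η ∉ T₀ := fun h => (snd_mem_coords_omitAt.1 h.2).2 rfl
  have hW := D.system.supp_W (hd hξ)
  have hnot := System.val_W_notMem_model e2 hξT (hd hξ)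
    ((D.resamp_snd ξ).mono (Set.subset_univ _)) (D.orderZero_snd ξ)
  have hsubW : ∀ x, D.system.W (snd ξ) x ⊆ ZFSet.powerset (D.system.cardSet (snd ξ) x) :=
    fun x z hz => ZFSet.mem_powerset.2 ((D.system.normal (snd ξ) x).subset z hz)
  have hyes := System.val_eq_of_rigid (S := D.system) e1 hηT (hd hη)
    ((D.resamp_snd η).mono (Set.subset_univ _))
    -- A transitive set containing the measure. Its elements are the measure and the subsets of the
    -- smaller cardinal, all rigid for the larger measure.
    (R := fun x => insert (D.system.W (snd ξ) x) (ZFSet.powerset (D.system.cardSet (snd ξ) x)))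
    (Eventually.of_forall fun x z hz y hy => by
      refine ZFSet.mem_insert_of_mem _ ?_
      rcases ZFSet.mem_insert_iff.1 hz with rfl | hz
      · exact hsubW x hy
      · exact ZFSet.mem_powerset.2
          ((D.system.isOrdinal_cardSet (snd ξ) x).subset_of_mem (ZFSet.mem_powerset.1 hz hy)))
    (hlt.mono fun x hx b hb => by
      have hc : (D.system.cardSet (snd ξ) x).card < D.system.card (snd η) x := by
        rwa [System.cardSet, Ordinal.card_toZFSet, Cardinal.card_ord]
      rcases ZFSet.mem_insert_iff.1 hb with rfl | hb
      · exact (D.system.completeBelow _ x).rigid_of_subset_powerset (hsubW x) hc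
      · exact (D.system.completeBelow _ x).rigid
          ((ZFSet.card_mono (ZFSet.mem_powerset.1 hb)).trans_lt hc))
    hW (Eventually.of_forall fun x => ZFSet.mem_insert _ _)
  intro h
  refine hnot (h ▸ hyes ▸ System.val_mem_model (hW.mono ?_))
  exact Set.inter_subset_left

/-- μ need not be increasing, so it is the filter that decides which of the two stages has the
smaller cardinal. -/
theorem model_omitAt_injOn (θ : Ordinal.{u}) :
    Set.InjOn (fun ξ => D.system.model (coords (omitAt ξ) θ)) (Set.Iio θ) := by
  intro ξ hξ η hη h
  by_contra hne
  have hsup : ∀ ζ, Supp Set.univ (D.system.card (snd ζ)) := fun ζ =>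
    D.system.supp_card (Set.subset_univ _)
  rcases D.system.em_of_supp ((hsup ξ).comp₂ (hsup η) (· < ·)) with h1 | h1
  · exact D.model_omitAt_ne_of_card_lt hξ hη hne h1 h
  · refine D.model_omitAt_ne_of_card_lt hη hξ (Ne.symm hne) ?_ h.symm
    filter_upwards [h1, D.eventually_card_ne hne] with x h2 h3
    exact lt_of_le_of_ne (not_lt.1 h2) h3.symm

/-! ### Mutual embeddability and conclusion -/

/-- Shifting all stages by `δ`. -/
noncomputable def shift (δ : Ordinal.{u}) (c : Coord.{u}) : Coord.{u} :=
  toLex (δ + (ofLex c).1, (ofLex c).2)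

theorem shift_strictMono (δ : Ordinal.{u}) : StrictMono (shift δ) := by
  intro c d h
  rw [Prod.Lex.lt_iff] at h
  refine Prod.Lex.toLex_lt_toLex.2 ?_
  rcases h with h | ⟨h, h'⟩
  · exact Or.inl (by simpa using h)
  · exact Or.inr ⟨by simp [h], h'⟩

/-- `ν.ord` is closed under addition, so a shift by η + 1 stays below it, and it lands strictly
above η, where no stage is omitted. -/
theorem nonempty_embedding_omitAt {ν : Cardinal.{u}} (hν : ℵ₀ ≤ ν) {η : Ordinal.{u}}
    (hη : η < ν.ord) (ξ : Ordinal.{u}) :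
    Nonempty (D.system.model (coords (omitAt ξ) ν.ord) ↪ₑ[setLang]
      D.system.model (coords (omitAt η) ν.ord)) := by
  have hη' : η + 1 < ν.ord := (Cardinal.isSuccLimit_ord hν).add_one_lt hη
  have hlt : ∀ β, β < ν.ord → η + 1 + β < ν.ord := fun β hβ =>
    Ordinal.isPrincipal_add_ord hν hη' hβ
  have hmaps : Set.MapsTo (shift (η + 1)) (coords (omitAt ξ) ν.ord) (coords (omitAt η) ν.ord) := by
    intro c hc
    rcases fst_or_snd c with ⟨β, rfl⟩ | ⟨β, rfl⟩
    · exact fst_mem_coords.2 (hlt β (fst_mem_coords.1 hc))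
    · refine snd_mem_coords_omitAt.2 ⟨hlt β (snd_mem_coords.1 hc).1, ?_⟩
      exact ((Order.lt_add_one_iff.2 le_rfl).trans_le (le_self_add (a := η + 1) (b := β))).ne'
  exact ⟨System.embedding (fun x => x ∘ shift (η + 1))
    (D.system.tendsto_reindex (shift_strictMono _) fun _ _ => rfl) fun F hF => hF.reindex hmaps⟩

/-- The model on no coordinates is V, and it embeds elementarily into every other. -/
theorem model_elementarilyEquivalent (T : Set Coord.{u}) [Small.{u} T] :
    D.system.model T ≅[setLang] (Set.univ : Set ZFSet.{u}) := by
  have h : ∀ M : Set ZFSet.{u}, M = Set.univ → (M ≅[setLang] D.system.model T) →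
      ((Set.univ : Set ZFSet.{u}) ≅[setLang] D.system.model T) := by
    rintro M rfl h
    exact h
  exact (h _ System.model_empty (D.incl (Set.empty_subset T)).elementarilyEquivalent).symm

end MeasureSeq

/-- Every measurable cardinal carries a normal measure that concentrates on ordinals without
normal ultrafilters. -/
theorem IsMeasurable.exists_orderZero {κ : Cardinal.{u}} (h : IsMeasurable κ) :
    ∃ (W : ZFSet.{u}) (hW : IsNormalMeasure κ W),
      ∀ᶠ ζ in hW.toIsMeasure.uf, ¬ ∃ w, IsNormalUF ζ w := by
  obtain ⟨l, hl, h0⟩ := IsNormalUF.exists_orderZero (ZFSet.isOrdinal_toZFSet κ.ord)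
    h.exists_isNormalUF
  obtain ⟨W', hW'⟩ := h
  refine ⟨_, hl.isNormalMeasure hW'.uncountable, ?_⟩
  rw [IsMeasure.eventually_iff, mem_measureSet]
  refine ⟨ZFSet.sep_subset, ?_⟩
  filter_upwards [h0, hl.mem] with ζ h1 h2 using ZFSet.mem_sep.2 ⟨h2, h1⟩

end MutualEmbed

theorem mainTheorem3 (κ : Cardinal.{u}) (hκ : MutualEmbed.IsMeasurable κ)
    (μ : Set.Iio κ.ord → Cardinal.{u}) (hinj : Function.Injective μ)
    (hμ : ∀ i, κ < μ i ∧ MutualEmbed.IsMeasurable (μ i)) :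
    ∃ (U : ZFSet.{u}) (v : Set.Iio κ.ord → ZFSet.{u}),
      MutualEmbed.IsNormalMeasure κ U ∧
      (∀ i, MutualEmbed.IsNormalMeasure (μ i) (v i) ∧ MutualEmbed.MitchellOrderZero (μ i) (v i)) ∧
      ∀ ν : Cardinal.{u}, ℵ₀ ≤ ν →
        ∃ 𝓜 : Set (Set ZFSet.{u}), #𝓜 = Cardinal.lift.{u + 1} ν ∧
          (∀ M ∈ 𝓜, MutualEmbed.IsTransClass M ∧ (∀ x : ZFSet.{u}, x.IsOrdinal → x ∈ M) ∧
            (M ≅[MutualEmbed.setLang] (Set.univ : Set ZFSet.{u})) ∧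
            ∃ (θ : Ordinal.{u}) (f : Ordinal.{u} → Bool)
              (I : MutualEmbed.Iteration κ U (MutualEmbed.seqSet κ v) θ f), I.model θ = M) ∧
          ∀ M ∈ 𝓜, ∀ N ∈ 𝓜, Nonempty (M ↪ₑ[MutualEmbed.setLang] N) := by
  open MutualEmbed in
  obtain ⟨U, hU, -⟩ := hκ.exists_orderZero
  choose v hv hv0 using fun i => (hμ i).2.exists_orderZero
  let D : MeasureSeq κ := ⟨μ, U, v, hU, hinj, fun i => (hμ i).1, hv, hv0⟩
  refine ⟨U, v, hU, fun i => ⟨hv i, (hv i).mitchellOrderZero (hv0 i)⟩, fun ν hν => ?_⟩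
  refine ⟨Set.range fun ξ : Set.Iio ν.ord =>
    D.system.model (MeasureSeq.coords (MeasureSeq.omitAt ξ) ν.ord), ?_, ?_, ?_⟩
  · rw [Cardinal.mk_range_eq _ fun ξ η h =>
      Subtype.ext (D.model_omitAt_injOn ν.ord ξ.2 η.2 h), Cardinal.mk_Iio_ordinal,
      Cardinal.card_ord]
  · rintro _ ⟨ξ, rfl⟩
    exact ⟨System.isTransClass_model, fun x hx => System.ordinal_mem_model hx,
      D.model_elementarilyEquivalent _, ν.ord, MeasureSeq.omitAt ξ, D.iteration _ _, rfl⟩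
  · rintro _ ⟨ξ, rfl⟩ _ ⟨η, rfl⟩
    exact D.nonempty_embedding_omitAt hν η.2 ξ
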